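/- Let $K$ be a field and let $\mathbb{S}_2$ be the associative unital $K$-algebra generated by $x_1,x_2,y_1,y_2$ subject to the defining relations $y_1x_1=y_2x_2=1$ and $[x_i,y_j]=[x_i,x_j]=[y_i,y_j]=0$ for $i\neq j$. For $i=1,2$ let $\mathbb{S}_1(i)$ be the subalgebra $K\langle x_i,y_i\rangle$ of $\mathbb{S}_2$, and for $k,l\in\mathbb{N}=\{0,1,\dots\}$ put $E_{kl}(i)=x_i^ky_i^l-x_i^{k+1}y_i^{l+1}$. Let $F_2$ be the $K$-linear span of all products $E_{ij}(1)E_{kl}(2)$ with $i,j,k,l\in\mathbb{N}$, and let $(1+F_2)^*$ be the group of units of the multiplicative monoid $1+F_2$. For $\{i,j\}=\{1,2\}$ let $U_i(K)=\{\lambda E_{00}(i)+1-E_{00}(i)\mid \lambda\in K^*\}$, and let $E_\infty(\mathbb{S}_1(j))$ be the subgroup of the group of units $\mathbb{S}_2^*$ generated by all elements $1+aE_{kl}(i)$ with $k\neq l$ and $a\in\mathbb{S}_1(j)$. Let $\Theta$ be the subgroup of $\mathbb{S}_2^*$ generated by the unit $$\theta=\bigl(1+(y_1-1)E_{00}(2)\bigr)\bigl(1+E_{00}(1)(x_2-1)\bigr),\qquad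 \theta^{-1}=\bigl(1+E_{00}(1)(y_2-1)\bigr)\bigl(1+(x_1-1)E_{00}(2)\bigr).$$ Then the map $\lambda\mapsto\lambda\cdot 1$ from $K^*$ to $\mathbb{S}_2^*$ and the maps $K^*\to U_i(K)$, $\lambda\mapsto\lambda E_{00}(i)+1-E_{00}(i)$, $i=1,2$, are injective, $\theta$ has infinite order (so $\Theta\simeq\mathbb{Z}$), and $$\mathbb{S}_2^*=K^*\times\Bigl(\Theta\ltimes\bigl((U_1(K)\ltimes E_\infty(\mathbb{S}_1(2)))\boxtimes_{(1+F_2)^*}(U_2(K)\ltimes E_\infty(\mathbb{S}_1(1)))\bigr)\Bigr),$$ where all products are internal products of subgroups of $\mathbb{S}_2^*$: $G=H\times N$ means that $H$ and $N$ are normal subgroups of $G$ with $H\cap N=1$ and $G=HN$; $G=H\ltimes N$ means that $H$ is a subgroup and $N$ a normal subgroup of $G$ with $H\cap N=1$ and $G=HN$; and $G=A\boxtimes_C B$ means that $A$ and $B$ are normal subgroups of $G$ with $A\cap B=C$ and $G=AB$. -/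

import Mathlib

/-! ### Internal products of subgroups

In the three definitions below all groups are subgroups of an ambient group `Γ`. -/

/-- `G = H × N` as an internal direct product: `H` and `N` are normal subgroups of `G` with trivial
intersection and `G = H N`. -/
structure IsInternalDirect {Γ : Type*} [Group Γ] (G H N : Subgroup Γ) : Prop where
  left_le : H ≤ G
  right_le : N ≤ G
  left_normal : (H.subgroupOf G).Normal
  right_normal : (N.subgroupOf G).Normal
  inf_eq : H ⊓ N = ⊥
  exists_eq_mul : ∀ g ∈ G, ∃ h ∈ H, ∃ n ∈ N, g = h * n

/-- `G = H ⋉ N` as an internal semidirect product: `H` and `N` are subgroups of `G`, `N` is normal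
in `G`, `H ∩ N = 1` and `G = H N`. -/
structure IsInternalSemidirect {Γ : Type*} [Group Γ] (G H N : Subgroup Γ) : Prop where
  left_le : H ≤ G
  right_le : N ≤ G
  right_normal : (N.subgroupOf G).Normal
  inf_eq : H ⊓ N = ⊥
  exists_eq_mul : ∀ g ∈ G, ∃ h ∈ H, ∃ n ∈ N, g = h * n

/-- `G = A ⊠_C B`: `A` and `B` are normal subgroups of `G` with `A ∩ B = C` and `G = A B`. -/
structure IsBoxProduct {Γ : Type*} [Group Γ] (G A B C : Subgroup Γ) : Prop where
  left_le : A ≤ G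
  right_le : B ≤ G
  left_normal : (A.subgroupOf G).Normal
  right_normal : (B.subgroupOf G).Normal
  inf_eq : A ⊓ B = C
  exists_eq_mul : ∀ g ∈ G, ∃ a ∈ A, ∃ b ∈ B, g = a * b

/-! ### The algebra of one-sided inverses -/

/-- The `2 n` generators `x_i`, `y_i`. -/
inductive OSIGen (n : ℕ) : Type
  | x (i : Fin n) : OSIGen n
  | y (i : Fin n) : OSIGen n

/-- The defining relations `y_i x_i = 1`, `[x_i, y_j] = [x_i, x_j] = [y_i, y_j] = 0` for
`i ≠ j`. -/
inductive OSIRel (K : Type*) [Field K] (n : ℕ) :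
    FreeAlgebra K (OSIGen n) → FreeAlgebra K (OSIGen n) → Prop
  | yx (i : Fin n) :
      OSIRel K n (FreeAlgebra.ι K (OSIGen.y i) * FreeAlgebra.ι K (OSIGen.x i)) 1
  | xy (i j : Fin n) (h : i ≠ j) :
      OSIRel K n (FreeAlgebra.ι K (OSIGen.x i) * FreeAlgebra.ι K (OSIGen.y j))
        (FreeAlgebra.ι K (OSIGen.y j) * FreeAlgebra.ι K (OSIGen.x i))
  | xx (i j : Fin n) (h : i ≠ j) :
      OSIRel K n (FreeAlgebra.ι K (OSIGen.x i) * FreeAlgebra.ι K (OSIGen.x j))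
        (FreeAlgebra.ι K (OSIGen.x j) * FreeAlgebra.ι K (OSIGen.x i))
  | yy (i j : Fin n) (h : i ≠ j) :
      OSIRel K n (FreeAlgebra.ι K (OSIGen.y i) * FreeAlgebra.ι K (OSIGen.y j))
        (FreeAlgebra.ι K (OSIGen.y j) * FreeAlgebra.ι K (OSIGen.y i))

/-- The algebra `𝕊_n` of one-sided inverses of the polynomial algebra in `n` variables over `K`. -/
def OSIAlg (K : Type*) [Field K] (n : ℕ) : Type _ := RingQuot (OSIRel K n)

noncomputable instance (K : Type*) [Field K] (n : ℕ) : Ring (OSIAlg K n) :=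
  inferInstanceAs (Ring (RingQuot (OSIRel K n)))

noncomputable instance (K : Type*) [Field K] (n : ℕ) : Algebra K (OSIAlg K n) :=
  inferInstanceAs (Algebra K (RingQuot (OSIRel K n)))

namespace OSI

section Generators

variable (K : Type*) [Field K] {n : ℕ}

/-- The quotient map from the free algebra on the generators to `𝕊_n`. -/
noncomputable def mk (n : ℕ) : FreeAlgebra K (OSIGen n) →ₐ[K] OSIAlg K n :=
  RingQuot.mkAlgHom K (OSIRel K n)

theorem mk_rel {a b : FreeAlgebra K (OSIGen n)} (h : OSIRel K n a b) : mk K n a = mk K n b :=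
  RingQuot.mkAlgHom_rel K h

/-- The generator `x_i` of `𝕊_n`. -/
noncomputable def x (i : Fin n) : OSIAlg K n :=
  mk K n (FreeAlgebra.ι K (OSIGen.x i))

/-- The generator `y_i` of `𝕊_n`. -/
noncomputable def y (i : Fin n) : OSIAlg K n :=
  mk K n (FreeAlgebra.ι K (OSIGen.y i))

theorem y_mul_x (i : Fin n) : y K i * x K i = 1 := by
  simpa [x, y] using mk_rel K (OSIRel.yx (K := K) i)

theorem commute_x_y {i j : Fin n} (h : i ≠ j) : Commute (x K i) (y K j) := by
  have := mk_rel K (OSIRel.xy (K := K) i j h)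
  simpa [x, y, Commute, SemiconjBy] using this

theorem commute_x_x {i j : Fin n} (h : i ≠ j) : Commute (x K i) (x K j) := by
  have := mk_rel K (OSIRel.xx (K := K) i j h)
  simpa [x, y, Commute, SemiconjBy] using this

theorem commute_y_y {i j : Fin n} (h : i ≠ j) : Commute (y K i) (y K j) := by
  have := mk_rel K (OSIRel.yy (K := K) i j h)
  simpa [x, y, Commute, SemiconjBy] using this

/-- The matrix units `E_{kl}(i) = x_i^k y_i^l - x_i^{k+1} y_i^{l+1}`. -/
noncomputable def E (i : Fin n) (k l : ℕ) : OSIAlg K n :=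
  x K i ^ k * y K i ^ l - x K i ^ (k + 1) * y K i ^ (l + 1)

/-- The subalgebra `𝕊_1(i) = K⟨x_i, y_i⟩` of `𝕊_n`. -/
noncomputable def S1 (i : Fin n) : Subalgebra K (OSIAlg K n) :=
  Algebra.adjoin K {x K i, y K i}

theorem E_eq (i : Fin n) (k l : ℕ) : E K i k l = x K i ^ k * E K i 0 0 * y K i ^ l := by
  simp only [E, pow_zero, zero_add, one_mul, mul_sub, sub_mul, mul_one, pow_succ (x K i),
    pow_succ' (y K i), mul_assoc]

theorem E00_eq (i : Fin n) : E K i 0 0 = 1 - x K i * y K i := by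
  simp [E]

theorem y_mul_E00 (i : Fin n) : y K i * E K i 0 0 = 0 := by
  rw [E00_eq, mul_sub, ← mul_assoc, y_mul_x]; simp

theorem E00_mul_x (i : Fin n) : E K i 0 0 * x K i = 0 := by
  rw [E00_eq, sub_mul, mul_assoc, y_mul_x]; simp

theorem E00_mul_E00 (i : Fin n) : E K i 0 0 * E K i 0 0 = E K i 0 0 := by
  nth_rewrite 2 [E00_eq]
  rw [mul_sub, ← mul_assoc, E00_mul_x]; simp

theorem y_pow_mul_x_pow (i : Fin n) (k : ℕ) : y K i ^ k * x K i ^ k = 1 := by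
  induction k with
  | zero => simp
  | succ k ih =>
    rw [pow_succ, pow_succ', mul_assoc, ← mul_assoc (y K i), y_mul_x, one_mul, ih]

theorem E_mul_E (i : Fin n) (k l p q : ℕ) :
    E K i k l * E K i p q = if l = p then E K i k q else 0 := by
  have key : E K i 0 0 * (y K i ^ l * x K i ^ p) * E K i 0 0 = if l = p then E K i 0 0 else 0 := by
    rcases lt_trichotomy l p with h | h | h
    · obtain ⟨d, rfl⟩ := Nat.exists_eq_add_of_lt h
      rw [if_neg h.ne, add_assoc, pow_add, ← mul_assoc (y K i ^ l), y_pow_mul_x_pow, one_mul,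
        pow_succ', ← mul_assoc (E K i 0 0), E00_mul_x]
      simp
    · subst h
      rw [y_pow_mul_x_pow, mul_one, if_pos rfl, E00_mul_E00]
    · obtain ⟨d, rfl⟩ := Nat.exists_eq_add_of_lt h
      rw [if_neg h.ne', add_assoc, add_comm p, pow_add, mul_assoc (y K i ^ (d + 1)),
        y_pow_mul_x_pow, mul_one, pow_succ, mul_assoc, mul_assoc, y_mul_E00]
      simp
  rw [E_eq K i k l, E_eq K i p q]
  have : x K i ^ k * E K i 0 0 * y K i ^ l * (x K i ^ p * E K i 0 0 * y K i ^ q) =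
      x K i ^ k * (E K i 0 0 * (y K i ^ l * x K i ^ p) * E K i 0 0) * y K i ^ q := by
    simp only [mul_assoc]
  rw [this, key]
  split_ifs
  · rw [← E_eq]
  · simp

theorem commute_E {i : Fin n} {a : OSIAlg K n} (hx : Commute a (x K i))
    (hy : Commute a (y K i)) (k l : ℕ) : Commute a (E K i k l) :=
  ((hx.pow_right k).mul_right (hy.pow_right l)).sub_right
    ((hx.pow_right (k + 1)).mul_right (hy.pow_right (l + 1)))

theorem commute_S1_E {i j : Fin n} (h : i ≠ j) (a : S1 K j) (k l : ℕ) :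
    Commute (a : OSIAlg K n) (E K i k l) := by
  obtain ⟨a, ha⟩ := a
  change Commute a _
  induction ha using Algebra.adjoin_induction with
  | mem z hz =>
    rcases hz with rfl | rfl
    · exact commute_E K (commute_x_x K h.symm) (commute_x_y K h.symm) k l
    · exact commute_E K (commute_x_y K h).symm (commute_y_y K h.symm) k l
  | algebraMap r => exact Algebra.commutes r _
  | add _ _ _ _ h1 h2 => exact h1.add_left h2
  | mul _ _ _ _ h1 h2 => exact h1.mul_left h2

theorem commute_E_E {i j : Fin n} (h : i ≠ j) (k l p q : ℕ) :
    Commute (E K i k l) (E K j p q) := by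
  refine (commute_S1_E K h ⟨E K j p q, ?_⟩ k l).symm
  have hx : x K j ∈ S1 K j := Algebra.subset_adjoin (by simp)
  have hy : y K j ∈ S1 K j := Algebra.subset_adjoin (by simp)
  exact sub_mem (mul_mem (pow_mem hx _) (pow_mem hy _)) (mul_mem (pow_mem hx _) (pow_mem hy _))

/-- The scalars `K^*`, as a homomorphism to `𝕊_n^*`. -/
noncomputable def scalar (n : ℕ) : Kˣ →* (OSIAlg K n)ˣ :=
  Units.map (algebraMap K (OSIAlg K n)).toMonoidHom

/-- `λ ↦ λ E_{00}(i) + 1 - E_{00}(i)`, as a homomorphism `K^* → 𝕊_n^*`. -/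
noncomputable def mu (i : Fin n) : Kˣ →* (OSIAlg K n)ˣ :=
  MonoidHom.toHomUnits
    { toFun := fun c => (c : K) • E K i 0 0 + 1 - E K i 0 0
      map_one' := by simp
      map_mul' := fun c d => by
        simp only [add_mul, sub_mul, mul_add, mul_sub, smul_mul_assoc, mul_smul_comm,
          E00_mul_E00, one_mul, mul_one, Units.val_mul, mul_smul]
        rw [smul_comm (c : K) (d : K) (E K i 0 0)]
        abel }

/-- `U_i(K) = {λ E_{00}(i) + 1 - E_{00}(i) | λ ∈ K^*}`. -/
noncomputable def U (i : Fin n) : Subgroup (OSIAlg K n)ˣ := (mu K i).range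

/-- The elementary matrix `1 + a E_{kl}(i)` with `k ≠ l` and `a ∈ 𝕊_1(j)`, where `j ≠ i`. -/
noncomputable def elementary {i j : Fin n} (h : i ≠ j) (a : S1 K j) {k l : ℕ} (hkl : k ≠ l) :
    (OSIAlg K n)ˣ :=
  have hsq : (a : OSIAlg K n) * E K i k l * (a * E K i k l) = 0 := by
    rw [mul_assoc, ← mul_assoc (E K i k l), ← (commute_S1_E K h a k l).eq, mul_assoc (a : OSIAlg K n),
      E_mul_E, if_neg hkl.symm]
    simp
  { val := 1 + a * E K i k l
    inv := 1 - a * E K i k l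
    val_inv := by rw [add_mul, mul_sub, one_mul, mul_sub, hsq]; simp
    inv_val := by rw [sub_mul, mul_add, one_mul, mul_add, hsq]; simp }

end Generators

section Two

variable (K : Type*) [Field K]

theorem ne_add_one (i : Fin 2) : i ≠ i + 1 := by
  fin_cases i <;> decide

/-- For `i : Fin 2` the other index is `i + 1` (addition modulo two). This is the subgroup
`E_∞(𝕊_1(i+1))` of `𝕊_2^*` generated by all elementary matrices `1 + a E_{kl}(i)` with `k ≠ l` and
`a ∈ 𝕊_1(i+1)`. -/
noncomputable def EInf (i : Fin 2) : Subgroup (OSIAlg K 2)ˣ :=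
  Subgroup.closure
    {u | ∃ (a : S1 K (i + 1)) (k l : ℕ) (hkl : k ≠ l), u = elementary K (ne_add_one i) a hkl}

/-- `F_2 = ⊕ K E_{αβ}`, where `E_{αβ} = E_{α_1 β_1}(1) E_{α_2 β_2}(2)`. -/
noncomputable def F2 : Submodule K (OSIAlg K 2) :=
  Submodule.span K
    {z | ∃ α β : Fin 2 → ℕ, z = E K (0 : Fin 2) (α 0) (β 0) * E K 1 (α 1) (β 1)}

theorem mul_mem_F2 {a b : OSIAlg K 2} (ha : a ∈ F2 K) (hb : b ∈ F2 K) : a * b ∈ F2 K := by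
  have h : F2 K * F2 K ≤ F2 K := by
    unfold F2
    rw [Submodule.span_mul_span, Submodule.span_le]
    rintro _ ⟨_, ⟨α, β, rfl⟩, _, ⟨γ, δ, rfl⟩, rfl⟩
    have hc := commute_E_E K (show (0 : Fin 2) ≠ 1 by decide) (γ 0) (δ 0) (α 1) (β 1)
    have : E K (0 : Fin 2) (α 0) (β 0) * E K 1 (α 1) (β 1) * (E K 0 (γ 0) (δ 0) * E K 1 (γ 1) (δ 1)) =
        (E K 0 (α 0) (β 0) * E K 0 (γ 0) (δ 0)) * (E K 1 (α 1) (β 1) * E K 1 (γ 1) (δ 1)) := by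
      rw [mul_assoc, ← mul_assoc (E K 1 (α 1) (β 1)), ← hc.eq]
      simp only [mul_assoc]
    change E K 0 (α 0) (β 0) * E K 1 (α 1) (β 1) * (E K 0 (γ 0) (δ 0) * E K 1 (γ 1) (δ 1)) ∈ _
    rw [this, E_mul_E, E_mul_E]
    split_ifs
    · exact Submodule.subset_span ⟨α, δ, rfl⟩
    all_goals simp
  exact h (Submodule.mul_mem_mul ha hb)

/-- `(1 + F_2)^*`, the group of units of the multiplicative monoid `1 + F_2`, as a subgroup of
`𝕊_2^*`. -/
noncomputable def unitsOneAddF2 : Subgroup (OSIAlg K 2)ˣ where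
  carrier := {u | (u : OSIAlg K 2) - 1 ∈ F2 K ∧ ((u⁻¹ : (OSIAlg K 2)ˣ) : OSIAlg K 2) - 1 ∈ F2 K}
  one_mem' := by simp
  mul_mem' := by
    have aux : ∀ a b : OSIAlg K 2, a - 1 ∈ F2 K → b - 1 ∈ F2 K → a * b - 1 ∈ F2 K := by
      intro a b ha hb
      have : a * b - 1 = (a - 1) * (b - 1) + (a - 1) + (b - 1) := by
        simp only [mul_sub, sub_mul, mul_one, one_mul]; abel
      rw [this]
      exact add_mem (add_mem (mul_mem_F2 K ha hb) ha) hb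
    rintro u v ⟨hu, hu'⟩ ⟨hv, hv'⟩
    refine ⟨aux _ _ hu hv, ?_⟩
    rw [mul_inv_rev]
    exact aux _ _ hv' hu'
  inv_mem' := by
    rintro u ⟨hu, hu'⟩
    exact ⟨hu', by simpa using hu⟩

theorem one_add_mul_one_add {R : Type*} [Ring R] {e p q : R} (he : e * e = e)
    (hp : Commute e p) :
    (1 + e * (p - 1)) * (1 + e * (q - 1)) = 1 + e * (p * q - 1) := by
  have h : e * (p - 1) * (e * (q - 1)) = e * ((p - 1) * (q - 1)) := by
    rw [(hp.sub_right (Commute.one_right e)).eq, mul_assoc, ← mul_assoc e, he, ← mul_assoc,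
      ← (hp.sub_right (Commute.one_right e)).eq, mul_assoc]
  have h' : (1 + e * (p - 1)) * (1 + e * (q - 1)) =
      1 + e * (p - 1) + e * (q - 1) + e * (p - 1) * (e * (q - 1)) := by
        rw [add_mul, one_mul, mul_add, mul_one]; abel
  rw [h', h]
  simp only [mul_sub, sub_mul, mul_one, one_mul]
  abel

theorem theta_aux {i j : Fin 2} (h : i ≠ j) :
    (1 + (y K i - 1) * E K j 0 0) * (1 + E K i 0 0 * (x K j - 1)) *
      ((1 + E K i 0 0 * (y K j - 1)) * (1 + (x K i - 1) * E K j 0 0)) = 1 := by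
  have hcx : Commute (E K i 0 0) (x K j) :=
    (commute_E K (commute_x_x K h.symm) (commute_x_y K h.symm) 0 0).symm
  have hcx' : Commute (E K j 0 0) (x K i) :=
    (commute_E K (commute_x_x K h) (commute_x_y K h) 0 0).symm
  have hcy' : Commute (E K j 0 0) (y K i) :=
    (commute_E K (commute_x_y K h.symm).symm (commute_y_y K h) 0 0).symm
  have hxy : x K j * y K j - 1 = - E K j 0 0 := by rw [E00_eq]; abel
  have h1 : (1 + E K i 0 0 * (x K j - 1)) * (1 + E K i 0 0 * (y K j - 1)) =
      1 - E K i 0 0 * E K j 0 0 := by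
    rw [one_add_mul_one_add (E00_mul_E00 K i) hcx, hxy, mul_neg, sub_eq_add_neg]
  have hce := (commute_E_E K h 0 0 0 0).eq
  have hy : (y K i - 1) * E K j 0 0 = E K j 0 0 * (y K i - 1) :=
    ((hcy'.sub_right (Commute.one_right _)).eq).symm
  have hx : (x K i - 1) * E K j 0 0 = E K j 0 0 * (x K i - 1) :=
    ((hcx'.sub_right (Commute.one_right _)).eq).symm
  have h2 : (1 + (y K i - 1) * E K j 0 0) * (1 - E K i 0 0 * E K j 0 0) =
      1 + (y K i - 1) * E K j 0 0 := by
    have h3 : (y K i - 1) * E K j 0 0 * (E K i 0 0 * E K j 0 0) = - (E K i 0 0 * E K j 0 0) := by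
      rw [hce, mul_assoc, ← mul_assoc (E K j 0 0) (E K j 0 0), E00_mul_E00, ← hce, sub_mul,
        ← mul_assoc, y_mul_E00]
      simp
    rw [add_mul, one_mul, mul_sub, mul_one, h3]
    abel
  rw [mul_assoc, ← mul_assoc (1 + E K i 0 0 * (x K j - 1)), h1, ← mul_assoc, h2, hy, hx,
    one_add_mul_one_add (E00_mul_E00 K j) hcy', y_mul_x]
  simp

theorem theta_aux' {i j : Fin 2} (h : i ≠ j) :
    (1 + E K i 0 0 * (y K j - 1)) * (1 + (x K i - 1) * E K j 0 0) *
      ((1 + (y K i - 1) * E K j 0 0) * (1 + E K i 0 0 * (x K j - 1))) = 1 := by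
  have hc : ∀ {i j : Fin 2}, i ≠ j → ∀ p, p = x K j ∨ p = y K j →
      (p - 1) * E K i 0 0 = E K i 0 0 * (p - 1) := by
    rintro i j h p (rfl | rfl)
    · exact ((commute_E K (commute_x_x K h.symm) (commute_x_y K h.symm) 0 0).sub_left
        (Commute.one_left _)).eq
    · exact ((commute_E K (commute_x_y K h).symm (commute_y_y K h.symm) 0 0).sub_left
        (Commute.one_left _)).eq
  have := theta_aux K h.symm
  rw [hc h.symm _ (Or.inl rfl), hc h.symm _ (Or.inr rfl), ← hc h _ (Or.inl rfl),
    ← hc h _ (Or.inr rfl)]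
  exact this

/-- `θ = (1 + (y_1 - 1) E_{00}(2)) (1 + E_{00}(1) (x_2 - 1))`, with inverse
`(1 + E_{00}(1) (y_2 - 1)) (1 + (x_1 - 1) E_{00}(2))`. -/
noncomputable def theta : (OSIAlg K 2)ˣ where
  val := (1 + (y K 0 - 1) * E K 1 0 0) * (1 + E K 0 0 0 * (x K 1 - 1))
  inv := (1 + E K 0 0 0 * (y K 1 - 1)) * (1 + (x K 0 - 1) * E K 1 0 0)
  val_inv := theta_aux K (by decide)
  inv_val := theta_aux' K (by decide)

/-- The subgroup `Θ` of `𝕊_2^*` generated by `θ`. -/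
noncomputable def Theta : Subgroup (OSIAlg K 2)ˣ := Subgroup.zpowers (theta K)

end Two

end OSI

/-! The indices 1, 2 of the statement are 0, 1 in `Fin 2`, and `i + 1` is the index other than `i`.
The representation `rho K i` lets x_i, y_i act as shifts on the free K[T;T⁻¹]-module on ℕ, and the
other x as the scalar T. Its kernel is the ideal `P K (i + 1)` generated by the E_kl(i+1), and `P K
0 ∩ P K 1 = F2 K`. The two factors of the box product are the kernels of `rhoU K 1` and `rhoU K 0`
on units: they are normal and meet in (1+F_2)^*.

A unit that is 1 modulo `P K 0 ⊔ P K 1` becomes under `rho K i` an invertible matrix that is the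
identity outside a finite block. Since K[T;T⁻¹] is Euclidean, elementary operations reduce it to
diag(c T^m, 1, 1, ...). These operations lift to `EInf K i`, and c lifts to `mu K i c`. If the unit
lies in the kernel of `rhoU K (i + 1)`, a Fredholm index argument on K[x_1,x_2] gives m = 0
(`eq_zero_of_rhoU_eq_diag`), so what is left lies in (1+F_2)^*. That group is contained in `EInf K
i` (`unitsOneAddF2_le_EInf`): its elements are finitary matrices over K, elementary operations
reduce them to a single diagonal entry, and even that entry is elementary, being a commutator made
from the one-sided inverse pair x_{i+1}, y_{i+1} (`exists_mem_EInf_eq`). The determinant shows that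
U_i and `EInf K i` meet trivially.

For an arbitrary unit, `eps` takes values in the units of a Laurent polynomial ring in two
variables, which are monomials. The index argument kills both exponents, so the unit is a scalar
modulo `P K 0 ⊔ P K 1`. Now `rhoU K 1` sends θ to diag(T⁻¹, 1, ...), so a power of θ absorbs the
remaining T^m, and by the index argument no nontrivial power of θ lies in the product of the two
kernels. Finally `eps` is 1 on θ and on both kernels, which separates them from the scalars. -/

/-! ### Column-finite matrices over a commutative ring -/

section FinitaryEnd

variable {R : Type*} [CommRing R] {ι : Type*}

/-- Endomorphisms of the free module on `ι`, that is, column-finite matrices. -/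
abbrev FinEnd (R : Type*) [CommRing R] (ι : Type*) : Type _ := Module.End R (ι →₀ R)

/-- The matrix unit `e_{ij}` as an endomorphism of the free module on `ι`. -/
noncomputable def matUnit (R : Type*) [CommRing R] {ι : Type*} (i j : ι) :
    FinEnd R ι :=
  Finsupp.lsingle i ∘ₗ Finsupp.lapply j

@[simp] theorem matUnit_apply (i j : ι) (v : ι →₀ R) :
    matUnit R i j v = Finsupp.single i (v j) := rfl

theorem matUnit_mul [DecidableEq ι] (i j k l : ι) :
    matUnit R i j * matUnit R k l = if j = k then matUnit R i l else 0 := by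
  refine LinearMap.ext fun v => ?_
  rw [Module.End.mul_apply, matUnit_apply, matUnit_apply, Finsupp.single_apply]
  by_cases h : j = k
  · simp [h]
  · simp [h, Ne.symm h]

/-- The transvection `1 + c e_{ij}` as a unit. -/
noncomputable def endTransvection {i j : ι} (h : i ≠ j) (c : R) : (FinEnd R ι)ˣ where
  val := 1 + c • matUnit R i j
  inv := 1 + (-c) • matUnit R i j
  val_inv := by
    classical
    rw [add_mul, mul_add, one_mul, mul_add, smul_mul_smul_comm, matUnit_mul, if_neg h.symm,
      smul_zero, add_zero, one_mul, mul_one, add_assoc, ← add_smul, neg_add_cancel, zero_smul,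
      add_zero]
  inv_val := by
    classical
    rw [add_mul, mul_add, one_mul, mul_add, smul_mul_smul_comm, matUnit_mul, if_neg h.symm,
      smul_zero, add_zero, one_mul, mul_one, add_assoc, ← add_smul, add_neg_cancel, zero_smul,
      add_zero]

/-- The group generated by the transvections. -/
noncomputable def endElementary (R : Type*) [CommRing R] (ι : Type*) :
    Subgroup (FinEnd R ι)ˣ :=
  Subgroup.closure {u | ∃ (i j : ι) (h : i ≠ j) (c : R), u = endTransvection h c}

theorem endTransvection_mem {i j : ι} (h : i ≠ j) (c : R) :
    endTransvection h c ∈ endElementary R ι :=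
  Subgroup.subset_closure ⟨i, j, h, c, rfl⟩

theorem endTransvection_apply {i j : ι} (h : i ≠ j) (c : R) (v : ι →₀ R) :
    (endTransvection h c : FinEnd R ι) v = v + Finsupp.single i (c * v j) := by
  simp [endTransvection]

/-- `T` agrees with the identity matrix outside the block `s × s`. -/
structure IsBlock (s : Finset ι) (T : FinEnd R ι) : Prop where
  col : ∀ j ∉ s, T (Finsupp.single j 1) = Finsupp.single j 1
  row : ∀ i ∉ s, ∀ v, T v i = v i

theorem IsBlock.one (s : Finset ι) : IsBlock s (1 : FinEnd R ι) :=
  ⟨fun _ _ => rfl, fun _ _ _ => rfl⟩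

theorem IsBlock.mul {s : Finset ι} {T T' : FinEnd R ι} (h : IsBlock s T)
    (h' : IsBlock s T') : IsBlock s (T * T') :=
  ⟨fun j hj => by rw [Module.End.mul_apply, h'.col j hj, h.col j hj],
    fun i hi v => by rw [Module.End.mul_apply, h.row i hi, h'.row i hi]⟩

theorem isBlock_endTransvection {s : Finset ι} {i j : ι} (h : i ≠ j) (hi : i ∈ s) (hj : j ∈ s)
    (c : R) : IsBlock s (endTransvection h c : FinEnd R ι) := by
  classical
  refine ⟨fun k hk => ?_, fun k hk v => ?_⟩
  · rw [endTransvection_apply, Finsupp.single_apply, if_neg (by rintro rfl; exact hk hj)]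
    simp
  · rw [endTransvection_apply, Finsupp.add_apply, Finsupp.single_apply,
      if_neg (by rintro rfl; exact hk hi), add_zero]

theorem IsBlock.mono {s t : Finset ι} (hst : s ⊆ t) {T : FinEnd R ι}
    (h : IsBlock s T) : IsBlock t T :=
  ⟨fun j hj => h.col j fun h' => hj (hst h'), fun i hi => h.row i fun h' => hi (hst h')⟩

theorem IsBlock.eq_of_singleton {a : ι} {T : FinEnd R ι} (h : IsBlock {a} T) :
    T = 1 + (T (Finsupp.single a 1) a - 1) • matUnit R a a := by
  classical
  refine Finsupp.lhom_ext' fun j => LinearMap.ext_ring ?_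
  refine Finsupp.ext fun i => ?_
  simp only [LinearMap.comp_apply, Finsupp.lsingle_apply, LinearMap.add_apply,
    Module.End.one_apply, LinearMap.smul_apply, matUnit_apply, Finsupp.add_apply,
    Finsupp.smul_apply, smul_eq_mul]
  by_cases hj : j = a
  · subst hj
    by_cases hi : i = j
    · subst hi; simp
    · rw [h.row i (by simpa using hi)]; simp [Ne.symm hi]
  · rw [h.col j (by simpa using hj)]; simp [hj]

/-! ### Elementary reduction of finitary matrices over a Euclidean ring. -/

section Reduction

variable [DecidableEq ι]

/-- Euclidean row operations leave at most one nonzero entry in a column. -/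
theorem exists_row_ops_aux {N : R → ℕ}
    (hN : ∀ a b : R, b ≠ 0 → ∃ q, N (a - q * b) < N b) {s : Finset ι} {a : ι} (ha : a ∈ s) (n : ℕ)
    (T : (FinEnd R ι)ˣ) (hT : IsBlock s (T : FinEnd R ι))
    (hn : ∑ i ∈ s, N ((T : FinEnd R ι) (Finsupp.single a 1) i) = n) :
    ∃ g ∈ endElementary R ι, IsBlock s ((g * T : (FinEnd R ι)ˣ) : FinEnd R ι) ∧
      ∃ b ∈ s, ∀ i, i ≠ b →
        ((g * T : (FinEnd R ι)ˣ) : FinEnd R ι) (Finsupp.single a 1) i = 0 := by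
  induction n using Nat.strong_induction_on generalizing T with
  | _ n ih =>
  by_cases hex : ∃ b ∈ s, ∃ b' ∈ s, b ≠ b' ∧
      (T : FinEnd R ι) (Finsupp.single a 1) b ≠ 0 ∧
      (T : FinEnd R ι) (Finsupp.single a 1) b' ≠ 0 ∧
      N ((T : FinEnd R ι) (Finsupp.single a 1) b) ≤
        N ((T : FinEnd R ι) (Finsupp.single a 1) b')
  · obtain ⟨b, hb, b', hb', hbb, h0, h0', hle⟩ := hex
    -- Replacing the entry of larger size by its remainder modulo the smaller one lowers the total
    -- size of the column, on which the induction runs.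
    obtain ⟨q, hq⟩ := hN ((T : FinEnd R ι) (Finsupp.single a 1) b') _ h0
    have hlt : ∑ i ∈ s, N (((endTransvection hbb.symm (-q) * T : (FinEnd R ι)ˣ) : FinEnd R ι)
        (Finsupp.single a 1) i) < n := by
      rw [← hn]
      refine Finset.sum_lt_sum (fun i _ => ?_) ⟨b', hb', ?_⟩
      · rw [Units.val_mul, Module.End.mul_apply, endTransvection_apply, Finsupp.add_apply,
          Finsupp.single_apply]
        split_ifs with h
        · subst h
          rw [neg_mul, ← sub_eq_add_neg]
          exact hq.le.trans hle
        · rw [add_zero]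
      · rw [Units.val_mul, Module.End.mul_apply, endTransvection_apply, Finsupp.add_apply,
          Finsupp.single_apply, if_pos rfl, neg_mul, ← sub_eq_add_neg]
        exact hq.trans_le hle
    obtain ⟨g, hg, hgT⟩ := ih _ hlt (endTransvection hbb.symm (-q) * T)
      ((isBlock_endTransvection hbb.symm hb' hb _).mul hT) rfl
    exact ⟨g * endTransvection hbb.symm (-q), mul_mem hg (endTransvection_mem _ _),
      by rwa [mul_assoc]⟩
  · push Not at hex
    refine ⟨1, one_mem _, by simpa using hT, ?_⟩
    rw [one_mul]
    have hout : ∀ i ∉ s, (T : FinEnd R ι) (Finsupp.single a 1) i = 0 := by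
      intro i hi
      rw [hT.row i hi, Finsupp.single_apply, if_neg (by rintro rfl; exact hi ha)]
    by_cases h : ∃ b ∈ s, (T : FinEnd R ι) (Finsupp.single a 1) b ≠ 0
    · obtain ⟨b, hb, hb0⟩ := h
      refine ⟨b, hb, fun i hib => ?_⟩
      by_contra hi0
      have his : i ∈ s := by by_contra his; exact hi0 (hout i his)
      -- Two distinct nonzero entries would each have to be strictly smaller than the other.
      have h1 := hex b hb i his hib.symm hb0 hi0
      have h2 := hex i his b hb hib hi0 hb0
      omega
    · push Not at h
      refine ⟨a, ha, fun i _ => ?_⟩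
      by_cases his : i ∈ s
      · exact h i his
      · exact hout i his

/-- Row operations turn the column at `a` into the standard one, if there is room for them. -/
theorem exists_row_ops {N : R → ℕ}
    (hN : ∀ a b : R, b ≠ 0 → ∃ q, N (a - q * b) < N b) {s : Finset ι} {a c : ι} (ha : a ∈ s) (hc : c ∈ s) (hac : a ≠ c)
    (T : (FinEnd R ι)ˣ) (hT : IsBlock s (T : FinEnd R ι)) :
    ∃ g ∈ endElementary R ι, IsBlock s ((g * T : (FinEnd R ι)ˣ) : FinEnd R ι) ∧
      ((g * T : (FinEnd R ι)ˣ) : FinEnd R ι) (Finsupp.single a 1) =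
        Finsupp.single a 1 := by
  have key : ∃ g ∈ endElementary R ι,
      IsBlock s ((g * T : (FinEnd R ι)ˣ) : FinEnd R ι) ∧ ∃ d : R,
      ((g * T : (FinEnd R ι)ˣ) : FinEnd R ι) (Finsupp.single a 1) =
        Finsupp.single a d := by
    obtain ⟨g, hg, hgT, b, hb, h0⟩ := exists_row_ops_aux hN ha _ T hT rfl
    have hcol : ((g * T : (FinEnd R ι)ˣ) : FinEnd R ι) (Finsupp.single a 1) =
        Finsupp.single b (((g * T : (FinEnd R ι)ˣ) : FinEnd R ι)
          (Finsupp.single a 1) b) := by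
      ext i
      rw [Finsupp.single_apply]
      split_ifs with h
      · rw [h]
      · exact h0 i (Ne.symm h)
    by_cases hba : b = a
    · subst hba; exact ⟨g, hg, hgT, _, hcol⟩
    -- The only nonzero entry sits in row b: add row b to row a, then subtract row a from row b.
    · refine ⟨endTransvection hba (-1) * endTransvection (Ne.symm hba) 1 * g,
        mul_mem (mul_mem (endTransvection_mem _ _) (endTransvection_mem _ _)) hg, ?_, ?_⟩
      · rw [mul_assoc, Units.val_mul, Units.val_mul]
        exact ((isBlock_endTransvection _ hb ha _).mul (isBlock_endTransvection _ ha hb _)).mul hgT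
      · refine ⟨((g * T : (FinEnd R ι)ˣ) : FinEnd R ι) (Finsupp.single a 1) b, ?_⟩
        rw [mul_assoc, Units.val_mul, Module.End.mul_apply, hcol, Units.val_mul,
          Module.End.mul_apply, endTransvection_apply, endTransvection_apply]
        ext i
        simp [hba]
  obtain ⟨g, hg, hgT, d, hd⟩ := key
  have hinv : ∃ d', d' * d = 1 := by
    refine ⟨(((g * T)⁻¹ : (FinEnd R ι)ˣ) : FinEnd R ι) (Finsupp.single a 1) a, ?_⟩
    have h1 : (((g * T)⁻¹ : (FinEnd R ι)ˣ) : FinEnd R ι)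
        (((g * T : (FinEnd R ι)ˣ) : FinEnd R ι) (Finsupp.single a 1)) =
        Finsupp.single a 1 := by
      rw [← Module.End.mul_apply, Units.inv_mul]; rfl
    rw [hd, show Finsupp.single a d = d • Finsupp.single a (1 : R) by simp, map_smul] at h1
    have := DFunLike.congr_fun h1 a
    simpa [mul_comm] using this
  obtain ⟨d', hd'⟩ := hinv
  -- On the rows (a, c) the column runs through (d, 0), (d, 1), (1, 1), (1, 0). The spare row c is
  -- what allows the unit d to be normalised to 1.
  refine ⟨endTransvection hac.symm (-1) * (endTransvection hac (1 - d) *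
    (endTransvection hac.symm d' * g)), mul_mem (endTransvection_mem _ _)
      (mul_mem (endTransvection_mem _ _) (mul_mem (endTransvection_mem _ _) hg)), ?_, ?_⟩
  · simp only [mul_assoc, Units.val_mul] at hgT ⊢
    exact (isBlock_endTransvection _ hc ha _).mul ((isBlock_endTransvection _ ha hc _).mul
      ((isBlock_endTransvection _ hc ha _).mul hgT))
  · simp only [mul_assoc, Units.val_mul, Module.End.mul_apply] at hd ⊢
    rw [hd, endTransvection_apply, endTransvection_apply, endTransvection_apply]
    ext i
    simp only [Finsupp.add_apply, Finsupp.single_apply, if_neg hac, if_neg hac.symm, if_true, hd']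
    by_cases h1 : a = i
    · subst h1; simp [hac.symm]
    · by_cases h2 : c = i
      · subst h2; simp [h1]
      · simp [h1, h2]

/-- Column operations clear the row at `a`. -/
theorem exists_col_ops {s : Finset ι} {a : ι} (ha : a ∉ s)
    (T : (FinEnd R ι)ˣ) (hT : IsBlock (insert a s) (T : FinEnd R ι))
    (hcol : (T : FinEnd R ι) (Finsupp.single a 1) = Finsupp.single a 1)
    (t : Finset ι) (ht : t ⊆ s) :
    ∃ g ∈ endElementary R ι,
      IsBlock (insert a s) ((T * g : (FinEnd R ι)ˣ) : FinEnd R ι) ∧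
      ((T * g : (FinEnd R ι)ˣ) : FinEnd R ι) (Finsupp.single a 1) =
        Finsupp.single a 1 ∧
      ∀ j ∈ t, ((T * g : (FinEnd R ι)ˣ) : FinEnd R ι) (Finsupp.single j 1) a = 0 := by
  induction t using Finset.induction_on with
  | empty => exact ⟨1, one_mem _, by simpa using hT, by simpa using hcol, by simp⟩
  | insert b t hbt ih =>
    obtain ⟨g, hg, h1, h2, h3⟩ := ih fun x hx => ht (Finset.mem_insert_of_mem hx)
    have hbs : b ∈ s := ht (Finset.mem_insert_self _ _)
    have hab : a ≠ b := by rintro rfl; exact ha hbs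
    -- Column a is already standard, so subtracting c times it from column b changes the entry (a,
    -- b) only.
    set c := ((T * g : (FinEnd R ι)ˣ) : FinEnd R ι) (Finsupp.single b 1) a with hcdef
    have happ : ∀ j, ((T * (g * endTransvection hab (-c)) : (FinEnd R ι)ˣ) :
        FinEnd R ι) (Finsupp.single j 1) =
        ((T * g : (FinEnd R ι)ˣ) : FinEnd R ι) (Finsupp.single j 1) +
          Finsupp.single a (if j = b then -c else 0) := by
      intro j
      rw [← mul_assoc, Units.val_mul (T * g), Module.End.mul_apply, endTransvection_apply, map_add]
      congr 1
      rw [Finsupp.single_apply]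
      split_ifs with h
      · rw [mul_one, show Finsupp.single a (-c) = (-c) • Finsupp.single a (1 : R) by simp,
          map_smul, h2]
      · simp
    refine ⟨g * endTransvection hab (-c), mul_mem hg (endTransvection_mem _ _), ?_, ?_, ?_⟩
    · rw [← mul_assoc, Units.val_mul (T * g)]
      exact h1.mul (isBlock_endTransvection _ (Finset.mem_insert_self _ _)
        (Finset.mem_insert_of_mem hbs) _)
    · rw [happ, h2, if_neg hab]; simp
    · intro j hj
      rw [happ, Finsupp.add_apply, Finsupp.single_eq_same]
      rcases Finset.mem_insert.1 hj with rfl | hj'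
      · rw [if_pos rfl, ← hcdef]; ring
      · rw [if_neg (by rintro rfl; exact hbt hj'), h3 j hj', add_zero]

/-- Over a Euclidean ring, every invertible finitary matrix is elementarily equivalent to a
diagonal matrix with a single nontrivial entry. -/
theorem exists_elementary_reduction {N : R → ℕ}
    (hN : ∀ a b : R, b ≠ 0 → ∃ q, N (a - q * b) < N b) (c : ι) (s : Finset ι) (hcs : c ∉ s)
    (T : (FinEnd R ι)ˣ) (hT : IsBlock (insert c s) (T : FinEnd R ι)) :
    ∃ g ∈ endElementary R ι, ∃ g' ∈ endElementary R ι, ∃ d : Rˣ,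
      ((g * T * g' : (FinEnd R ι)ˣ) : FinEnd R ι) =
        1 + ((d : R) - 1) • matUnit R c c := by
  induction s using Finset.induction_on generalizing T with
  | empty =>
    refine ⟨1, one_mem _, 1, one_mem _, ?_⟩
    rw [one_mul, mul_one]
    have h := IsBlock.eq_of_singleton (by simpa using hT)
    set d := (T : FinEnd R ι) (Finsupp.single c 1) c
    have h1 : (T : FinEnd R ι) (Finsupp.single c 1) = d • Finsupp.single c 1 := by
      rw [h]
      simp
    have h2 : ((T⁻¹ : (FinEnd R ι)ˣ) : FinEnd R ι)
        ((T : FinEnd R ι) (Finsupp.single c 1)) = Finsupp.single c 1 := by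
      rw [← Module.End.mul_apply, Units.inv_mul]; rfl
    rw [h1, map_smul] at h2
    have h3 := DFunLike.congr_fun h2 c
    rw [Finsupp.smul_apply, smul_eq_mul, Finsupp.single_eq_same] at h3
    exact ⟨Units.mkOfMulEqOne _ _ h3, h⟩
  | insert a s has ih =>
    have hac : a ≠ c := by rintro rfl; exact hcs (Finset.mem_insert_self _ _)
    have hcs' : c ∉ s := fun h => hcs (Finset.mem_insert_of_mem h)
    -- The index a is eliminated while c stays in the block: c serves as the spare row and collects
    -- the final diagonal entry.
    rw [Finset.insert_comm] at hT
    have ha' : a ∉ insert c s := by simp [hac, has]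
    obtain ⟨g₁, hg₁, hb₁, hcol⟩ := exists_row_ops hN (Finset.mem_insert_self a _)
      (Finset.mem_insert_of_mem (Finset.mem_insert_self c s)) hac T hT
    obtain ⟨g₂, hg₂, hb₂, hcol₂, hrow⟩ := exists_col_ops ha' _ hb₁ hcol _ subset_rfl
    have hblock : IsBlock (insert c s) ((g₁ * T * g₂ : (FinEnd R ι)ˣ) : FinEnd R ι) := by
      refine ⟨fun j hj => ?_, fun i hi v => ?_⟩
      · by_cases hja : j = a
        · rw [hja, hcol₂]
        · exact hb₂.col j (by simp only [Finset.mem_insert] at hj ⊢; tauto)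
      · by_cases hia : i = a
        · subst hia
          have : Finsupp.lapply i ∘ₗ ((g₁ * T * g₂ : (FinEnd R ι)ˣ) : FinEnd R ι) =
              (Finsupp.lapply i : (ι →₀ R) →ₗ[R] R) := by
            refine Finsupp.lhom_ext' fun j => LinearMap.ext_ring ?_
            simp only [LinearMap.comp_apply, Finsupp.lsingle_apply, Finsupp.lapply_apply]
            by_cases hji : j = i
            · rw [hji, hcol₂]
            · by_cases hj : j ∈ insert c s
              · rw [hrow j hj]; simp [hji]
              · rw [hb₂.col j (by simp only [Finset.mem_insert] at hj ⊢; tauto)]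
          exact LinearMap.congr_fun this v
        · exact hb₂.row i (by simp only [Finset.mem_insert] at hi ⊢; tauto) v
    obtain ⟨g, hg, g', hg', d, hd⟩ := ih hcs' (g₁ * T * g₂) hblock
    exact ⟨g * g₁, mul_mem hg hg₁, g₂ * g', mul_mem hg₂ hg', d,
      by rw [← hd]; simp only [mul_assoc]⟩

end Reduction

/-- An injective endomorphism cannot map a coordinate subspace into a smaller one. -/
theorem card_le_card_of_injective_of_apply_mem [Nontrivial R] {T : FinEnd R ι}
    (hT : Function.Injective T) {s t : Finset ι}
    (h : ∀ j ∈ s, ∀ i ∉ t, T (Finsupp.single j 1) i = 0) : s.card ≤ t.card := by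
  classical
  -- Restricting to the coordinates in s and projecting to those in t stays injective, because by
  -- hypothesis nothing is lost outside t.
  have key := card_le_of_injective'' (R := R) (α := s) (β := t)
    (Finsupp.lcomapDomain (fun i : t => (i : ι)) Subtype.val_injective ∘ₗ T ∘ₗ
      Finsupp.lmapDomain R R (fun j : s => (j : ι))) ?_
  · simpa using key
  · intro v w hvw
    apply Finsupp.mapDomain_injective Subtype.val_injective
    apply hT
    have hsupp : ∀ v : s →₀ R, ∀ i ∉ t, T (Finsupp.mapDomain (fun j : s => (j : ι)) v) i = 0 := by
      intro v i hi
      induction v using Finsupp.induction_linear with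
      | zero => simp
      | add v w hv hw => rw [Finsupp.mapDomain_add, map_add, Finsupp.add_apply, hv, hw, add_zero]
      | single j c =>
        rw [Finsupp.mapDomain_single, show Finsupp.single (j : ι) c = c • Finsupp.single (j : ι) 1 by
          simp, map_smul, Finsupp.smul_apply, h j j.2 i hi, smul_zero]
    ext i
    by_cases hi : i ∈ t
    · exact DFunLike.congr_fun hvw ⟨i, hi⟩
    · rw [hsupp v i hi, hsupp w i hi]

/-! ### Determinants of finite corners. -/

section Det

/-- The upper left corner of an endomorphism as a finite matrix. -/
noncomputable def corner (n : ℕ) (T : FinEnd R ℕ) : Matrix (Fin n) (Fin n) R :=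
  Matrix.of fun i j => T (Finsupp.single (j : ℕ) 1) i

/-- The first n columns of T' are supported in the first n rows, so no term of the product leaves
the corner. Nothing is needed of T. -/
theorem corner_mul {n : ℕ} (T : FinEnd R ℕ) {T' : FinEnd R ℕ}
    (h' : IsBlock (Finset.range n) T') : corner n (T * T') = corner n T * corner n T' := by
  ext i j
  simp only [corner, Matrix.of_apply, Matrix.mul_apply, Module.End.mul_apply]
  have hsum : T' (Finsupp.single (j : ℕ) 1) =
      ∑ k : Fin n, T' (Finsupp.single (j : ℕ) 1) k • Finsupp.single (k : ℕ) (1 : R) := by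
    ext m
    rw [Finsupp.finsetSum_apply]
    by_cases hm : m < n
    · rw [Finset.sum_eq_single (⟨m, hm⟩ : Fin n)]
      · simp
      · intro k _ hk
        have : (k : ℕ) ≠ m := fun h => hk (Fin.ext h)
        simp [this]
      · simp
    · rw [h'.row m (by simpa using hm), Finset.sum_eq_zero]
      · have : (j : ℕ) ≠ m := by omega
        simp [this]
      · intro k _
        have : (k : ℕ) ≠ m := by omega
        simp [this]
  conv_lhs => rw [hsum]
  rw [map_sum, Finsupp.finsetSum_apply]
  refine Finset.sum_congr rfl fun k _ => ?_
  rw [map_smul, Finsupp.smul_apply, smul_eq_mul, mul_comm]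

/-- A stable determinant without a limit: each transvection has determinant 1 in every corner that
contains it, and corners are multiplicative on blocks. Asking for all large m lets the bounds for
two factors be merged. -/
theorem det_corner_of_mem_endElementary {g : (FinEnd R ℕ)ˣ} (hg : g ∈ endElementary R ℕ) :
    ∃ n, ∀ m ≥ n, IsBlock (Finset.range m) (g : FinEnd R ℕ) ∧
      (corner m (g : FinEnd R ℕ)).det = 1 := by
  have htr : ∀ {i j : ℕ} (h : i ≠ j) (c : R), ∃ n, ∀ m ≥ n,
      IsBlock (Finset.range m) (endTransvection h c : FinEnd R ℕ) ∧
      (corner m (endTransvection h c : FinEnd R ℕ)).det = 1 := by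
    intro i j h c
    refine ⟨max i j + 1, fun m hm => ?_⟩
    have hi : i < m := by omega
    have hj : j < m := by omega
    refine ⟨isBlock_endTransvection h (by simpa) (by simpa) c, ?_⟩
    have : corner m (endTransvection h c : FinEnd R ℕ) =
        Matrix.transvection (⟨i, hi⟩ : Fin m) ⟨j, hj⟩ c := by
      ext a b
      rw [corner, Matrix.of_apply, endTransvection_apply, Finsupp.add_apply, Matrix.transvection,
        Matrix.add_apply, Matrix.one_apply, Matrix.single_apply, Finsupp.single_apply,
        Finsupp.single_apply, Finsupp.single_apply]
      simp only [Fin.ext_iff, eq_comm (a := (b : ℕ))]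
      by_cases h1 : i = a <;> by_cases h2 : j = b <;> simp [h1, h2]
    rw [this, Matrix.det_transvection_of_ne _ _ (by simpa [Fin.ext_iff] using h)]
  induction hg using Subgroup.closure_induction with
  | mem g hg =>
    obtain ⟨i, j, h, c, rfl⟩ := hg
    exact htr h c
  | one =>
    refine ⟨0, fun m _ => ⟨IsBlock.one _, ?_⟩⟩
    have : corner m ((1 : (FinEnd R ℕ)ˣ) : FinEnd R ℕ) = 1 := by
      ext a b
      simp [corner, Matrix.one_apply, Finsupp.single_apply, Fin.ext_iff, eq_comm]
    rw [this, Matrix.det_one]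
  | mul g g' _ _ ih ih' =>
    obtain ⟨n, hn⟩ := ih
    obtain ⟨n', hn'⟩ := ih'
    refine ⟨max n n', fun m hm => ?_⟩
    obtain ⟨h1, h2⟩ := hn m (le_trans (le_max_left _ _) hm)
    obtain ⟨h1', h2'⟩ := hn' m (le_trans (le_max_right _ _) hm)
    refine ⟨h1.mul h1', ?_⟩
    rw [Units.val_mul, corner_mul _ h1', Matrix.det_mul, h2, h2', one_mul]
  | inv g _ ih =>
    obtain ⟨n, hn⟩ := ih
    refine ⟨n, fun m hm => ?_⟩
    obtain ⟨h1, h2⟩ := hn m hm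
    have hinv : ∀ v, ((g⁻¹ : (FinEnd R ℕ)ˣ) : FinEnd R ℕ) ((g : FinEnd R ℕ) v) = v := fun v => by
      rw [← Module.End.mul_apply, Units.inv_mul]; rfl
    have hinv' : ∀ v, (g : FinEnd R ℕ) (((g⁻¹ : (FinEnd R ℕ)ˣ) : FinEnd R ℕ) v) = v := fun v => by
      rw [← Module.End.mul_apply, Units.mul_inv]; rfl
    have h3 : IsBlock (Finset.range m) ((g⁻¹ : (FinEnd R ℕ)ˣ) : FinEnd R ℕ) := by
      refine ⟨fun j hj => ?_, fun i hi v => ?_⟩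
      · conv_lhs => rw [← h1.col j hj, hinv]
      · conv_rhs => rw [← hinv' v, h1.row i hi]
    refine ⟨h3, ?_⟩
    have h4 := congrArg Matrix.det (corner_mul (g : FinEnd R ℕ) h3)
    rw [Units.mul_inv, Matrix.det_mul, h2, one_mul] at h4
    rw [← h4]
    have : corner m (1 : FinEnd R ℕ) = 1 := by
      ext a b
      simp [corner, Matrix.one_apply, Finsupp.single_apply, Fin.ext_iff, eq_comm]
    rw [this, Matrix.det_one]

/-- The entry d is the determinant of every nonempty corner. This is what separates U_i(K) from the
elementary group. -/
theorem eq_one_of_diag_mem_endElementary {g : (FinEnd R ℕ)ˣ} (hg : g ∈ endElementary R ℕ) {d : R}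
    (h : (g : FinEnd R ℕ) = 1 + (d - 1) • matUnit R 0 0) : d = 1 := by
  obtain ⟨n, hn⟩ := det_corner_of_mem_endElementary hg
  obtain ⟨-, h1⟩ := hn (n + 1) (by omega)
  have : corner (n + 1) (g : FinEnd R ℕ) = Matrix.diagonal (Function.update 1 0 d) := by
    ext a b
    rw [h]
    rw [corner, Matrix.of_apply, LinearMap.add_apply, Module.End.one_apply, LinearMap.smul_apply,
      matUnit_apply, Finsupp.add_apply, Finsupp.smul_apply, Finsupp.single_apply,
      Finsupp.single_apply, Finsupp.single_apply, Matrix.diagonal_apply, Function.update_apply,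
      Pi.one_apply]
    have e1 : ((b : ℕ) = a) = (a = b) := by rw [Fin.ext_iff]; exact propext eq_comm
    have e2 : (0 = (a : ℕ)) = (a = 0) := by
      rw [Fin.ext_iff, Fin.val_zero]; exact propext eq_comm
    have e3 : ((b : ℕ) = 0) = (b = 0) := by rw [Fin.ext_iff, Fin.val_zero]
    simp only [e1, e2, e3]
    by_cases ha : a = 0
    · subst ha
      by_cases hb : b = 0
      · subst hb; simp
      · simp [hb, Ne.symm hb]
    · by_cases hab : a = b
      · subst hab; simp [ha]
      · simp [ha, hab]
  rw [this, Matrix.det_diagonal, Finset.prod_update_of_mem (Finset.mem_univ _)] at h1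
  simpa using h1

end Det

end FinitaryEnd
/-! ### Laurent polynomials -/

section Laurent

open LaurentPolynomial
open Polynomial (toLaurent)

/-- The units of the Laurent polynomial ring over a domain are the monomials. -/
theorem LaurentPolynomial.exists_eq_C_mul_T_of_isUnit {R : Type*} [CommRing R] [IsDomain R]
    {f : R[T;T⁻¹]} (hf : IsUnit f) : ∃ c : Rˣ, ∃ n : ℤ, f = C (c : R) * T n := by
  obtain ⟨g, hg⟩ := hf.exists_right_inv
  obtain ⟨n, p, hp⟩ := exists_T_pow f
  obtain ⟨m, q, hq⟩ := exists_T_pow g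
  have hpq : p * q = Polynomial.X ^ (n + m) := by
    apply Polynomial.toLaurent_injective
    rw [map_mul, hp, hq, Polynomial.toLaurent_X_pow, mul_mul_mul_comm, hg, one_mul, ← T_add]
    push_cast
    rfl
  -- With denominators cleared, p divides a power of the prime X, hence is associated to a power of
  -- X.
  obtain ⟨k, -, hk⟩ := (dvd_prime_pow Polynomial.prime_X _).1 (Dvd.intro q hpq)
  obtain ⟨u, hu⟩ := hk.symm
  obtain ⟨c, hc, hcu⟩ := Polynomial.isUnit_iff.1 u.isUnit
  refine ⟨hc.unit, k - n, ?_⟩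
  have hf' : f = toLaurent p * T (-n) := by
    rw [hp, mul_T_assoc, add_neg_cancel, T_zero, mul_one]
  rw [hf', ← hu, ← hcu, mul_comm (Polynomial.X ^ k), Polynomial.toLaurent_C_mul_X_pow, mul_T_assoc,
    ← sub_eq_add_neg]
  rfl

/-- A Euclidean size function on Laurent polynomials over a field. -/
theorem LaurentPolynomial.exists_euclidean (K : Type*) [Field K] :
    ∃ N : K[T;T⁻¹] → ℕ, ∀ a b : K[T;T⁻¹], b ≠ 0 → ∃ q, N (a - q * b) < N b := by
  classical
  have hex : ∀ f : K[T;T⁻¹], ∃ n, ∃ (k : ℤ) (p : Polynomial K),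
      f = toLaurent p * T k ∧ (if p = 0 then 0 else p.natDegree + 1) = n := by
    intro f
    obtain ⟨n, p, hp⟩ := exists_T_pow f
    exact ⟨_, -n, p, by rw [hp, mul_T_assoc, add_neg_cancel, T_zero, mul_one], rfl⟩
  -- The size of f is the least value of degree plus one over all representations of f as a
  -- polynomial times a power of T, with value 0 for the zero polynomial.
  refine ⟨fun f => Nat.find (hex f), fun a b hb => ?_⟩
  obtain ⟨k, q, hq, hqn⟩ := Nat.find_spec (hex b)
  obtain ⟨n, p, hp⟩ := exists_T_pow a
  have ha : a = toLaurent p * T (-n) := by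
    rw [hp, mul_T_assoc, add_neg_cancel, T_zero, mul_one]
  have hq0 : q ≠ 0 := by
    rintro rfl
    exact hb (by rw [hq, map_zero, zero_mul])
  -- Polynomial division of p by q, corrected by powers of the unit T. Only q has to be a
  -- representative of minimal degree.
  refine ⟨toLaurent (p / q) * T (-n - k), ?_⟩
  have hmod : a - toLaurent (p / q) * T (-n - k) * b = toLaurent (p % q) * T (-n) := by
    have h1 : toLaurent (p / q) * T (-n - k) * (toLaurent q * T k) =
        toLaurent (p / q) * toLaurent q * (T (-n) : K[T;T⁻¹]) := by
      rw [mul_mul_mul_comm, ← T_add, sub_add_cancel]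
    rw [hq, h1, ha, ← sub_mul, ← map_mul, ← map_sub, EuclideanDomain.mod_eq_sub_mul_div,
      mul_comm q]
  refine lt_of_le_of_lt (b := if p % q = 0 then 0 else (p % q).natDegree + 1)
    (Nat.find_min' (hex _) ⟨-n, p % q, hmod, rfl⟩) ?_
  change _ < Nat.find (hex b)
  rw [← hqn, if_neg hq0]
  split_ifs with h
  · omega
  · have := Polynomial.natDegree_lt_natDegree h (EuclideanDomain.mod_lt p hq0)
    omega

/-- A size function witnessing that a field is Euclidean. -/
theorem Field.exists_euclidean (K : Type*) [Field K] :
    ∃ N : K → ℕ, ∀ a b : K, b ≠ 0 → ∃ q, N (a - q * b) < N b := by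
  classical
  refine ⟨fun a => if a = 0 then 0 else 1, fun a b hb => ⟨a / b, ?_⟩⟩
  simp [hb]

end Laurent
/-! ### Structure of `𝕊_2` -/

namespace OSI

section Structure

variable {K : Type*} [Field K]

/-- The universal property of `𝕊_n`. -/
noncomputable def lift {n : ℕ} {A : Type*} [Semiring A] [Algebra K A] (X Y : Fin n → A)
    (hyx : ∀ i, Y i * X i = 1) (hxy : ∀ i j, i ≠ j → X i * Y j = Y j * X i)
    (hxx : ∀ i j, i ≠ j → X i * X j = X j * X i) (hyy : ∀ i j, i ≠ j → Y i * Y j = Y j * Y i) :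
    OSIAlg K n →ₐ[K] A :=
  RingQuot.liftAlgHom K ⟨FreeAlgebra.lift K fun g => match g with
    | OSIGen.x i => X i
    | OSIGen.y i => Y i, fun a b h => by
      cases h with
      | yx i => simpa using hyx i
      | xy i j h => simpa using hxy i j h
      | xx i j h => simpa using hxx i j h
      | yy i j h => simpa using hyy i j h⟩

section Lift

variable {n : ℕ} {A : Type*} [Semiring A] [Algebra K A] {X Y : Fin n → A}
    (hyx : ∀ i, Y i * X i = 1) (hxy : ∀ i j, i ≠ j → X i * Y j = Y j * X i)
    (hxx : ∀ i j, i ≠ j → X i * X j = X j * X i) (hyy : ∀ i j, i ≠ j → Y i * Y j = Y j * Y i)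

theorem lift_x (i : Fin n) : lift X Y hyx hxy hxx hyy (x K i) = X i := by
  unfold lift x mk
  exact (RingQuot.liftAlgHom_mkAlgHom_apply _ _ _ _).trans (FreeAlgebra.lift_ι_apply _ _)

theorem lift_y (i : Fin n) : lift X Y hyx hxy hxx hyy (y K i) = Y i := by
  unfold lift y mk
  exact (RingQuot.liftAlgHom_mkAlgHom_apply _ _ _ _).trans (FreeAlgebra.lift_ι_apply _ _)

end Lift

/-- A subspace stable under left multiplication by the generators is a left ideal. -/
theorem mul_mem_of_generators {n : ℕ} {W : Submodule K (OSIAlg K n)}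
    (hx : ∀ i, ∀ w ∈ W, x K i * w ∈ W) (hy : ∀ i, ∀ w ∈ W, y K i * w ∈ W) (a : OSIAlg K n) :
    ∀ w ∈ W, a * w ∈ W := by
  obtain ⟨a, rfl⟩ : ∃ b, mk K n b = a := RingQuot.mkAlgHom_surjective K (OSIRel K n) a
  induction a using FreeAlgebra.induction with
  | grade0 r =>
    intro w hw
    rw [AlgHom.commutes, ← Algebra.smul_def]
    exact W.smul_mem r hw
  | grade1 g =>
    cases g with
    | x i => exact hx i
    | y i => exact hy i
  | mul a b ha hb =>
    intro w hw
    rw [map_mul, mul_assoc]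
    exact ha _ (hb _ hw)
  | add a b ha hb =>
    intro w hw
    rw [map_add, add_mul]
    exact add_mem (ha _ hw) (hb _ hw)

theorem eq_top_of_generators {n : ℕ} {W : Submodule K (OSIAlg K n)} (h1 : 1 ∈ W)
    (hx : ∀ i, ∀ w ∈ W, x K i * w ∈ W) (hy : ∀ i, ∀ w ∈ W, y K i * w ∈ W) : W = ⊤ :=
  (Submodule.eq_top_iff').2 fun a => by simpa using mul_mem_of_generators hx hy a 1 h1

theorem fin_two_eq_or (i k : Fin 2) : k = i ∨ k = i + 1 := by
  revert i k; decide

theorem fin_two_add_one_add_one (i : Fin 2) : i + 1 + 1 = i := by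
  revert i; decide

section Single

variable {n : ℕ} (i : Fin n)

theorem x_mul_E (k l : ℕ) : x K i * E K i k l = E K i (k + 1) l := by
  rw [E_eq, E_eq K i (k + 1), pow_succ']
  simp only [mul_assoc]

theorem y_mul_E_succ (k l : ℕ) : y K i * E K i (k + 1) l = E K i k l := by
  rw [← x_mul_E, ← mul_assoc, y_mul_x, one_mul]

theorem y_mul_E_zero (l : ℕ) : y K i * E K i 0 l = 0 := by
  rw [E_eq, pow_zero, one_mul, ← mul_assoc, y_mul_E00, zero_mul]

/-- The powers `x_i^b`, where `x_i^{-n}` stands for `y_i^n`. -/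
noncomputable def xz : ℤ → OSIAlg K n
  | Int.ofNat b => x K i ^ b
  | Int.negSucc b => y K i ^ (b + 1)

theorem xz_natCast (b : ℕ) : xz (K := K) i (b : ℤ) = x K i ^ b := rfl

theorem xz_zero : xz (K := K) i 0 = 1 := pow_zero _

theorem xz_neg_natCast (b : ℕ) : xz (K := K) i (-(b : ℤ)) = y K i ^ b := by
  cases b with
  | zero => rw [Nat.cast_zero, neg_zero, xz_zero, pow_zero]
  | succ b => rfl

theorem y_mul_xz (b : ℤ) : y K i * xz i b = xz i (b - 1) := by
  obtain ⟨b, rfl | rfl⟩ := b.eq_nat_or_neg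
  · cases b with
    | zero =>
      rw [Nat.cast_zero, xz_zero, mul_one, show (0 : ℤ) - 1 = -((1 : ℕ) : ℤ) by simp,
        xz_neg_natCast, pow_one]
    | succ b =>
      rw [xz_natCast, pow_succ', ← mul_assoc, y_mul_x, one_mul,
        show ((b + 1 : ℕ) : ℤ) - 1 = (b : ℤ) by simp, xz_natCast]
  · rw [xz_neg_natCast, show -(b : ℤ) - 1 = -((b + 1 : ℕ) : ℤ) by push_cast; ring,
      xz_neg_natCast, pow_succ']

theorem x_mul_xz_of_nonneg {b : ℤ} (hb : 0 ≤ b) : x K i * xz i b = xz i (b + 1) := by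
  lift b to ℕ using hb
  rw [xz_natCast, ← pow_succ', ← xz_natCast]
  simp

/-- The failure of `xz` to be multiplicative comes from x_i y_i = 1 - E_00(i). The error is one
matrix unit, which the ideals `P` absorb. -/
theorem x_mul_xz_of_neg (b : ℕ) :
    x K i * xz i (-((b + 1 : ℕ) : ℤ)) = xz i (-(b : ℤ)) - E K i 0 b := by
  rw [xz_neg_natCast, xz_neg_natCast, E_eq, E00_eq, pow_zero, one_mul, sub_mul, one_mul,
    mul_assoc, ← pow_succ', sub_sub_cancel]

theorem commute_xz {a : OSIAlg K n} (hx : Commute a (x K i)) (hy : Commute a (y K i)) (b : ℤ) :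
    Commute a (xz i b) := by
  cases b with
  | ofNat b => exact hx.pow_right b
  | negSucc b => exact hy.pow_right (b + 1)

end Single

/-! ### The ideals `P`, their intersection, and normal forms modulo them. -/

/-- The left ideal generated by the matrix units `E_{kl}(i)`. -/
noncomputable def P (K : Type*) [Field K] (i : Fin 2) : Ideal (OSIAlg K 2) :=
  Ideal.span (Set.range fun p : ℕ × ℕ => E K i p.1 p.2)

theorem E_mem_P (i : Fin 2) (k l : ℕ) : E K i k l ∈ P K i :=
  Ideal.subset_span ⟨(k, l), rfl⟩

theorem smul_mem_ideal {I : Ideal (OSIAlg K 2)} (c : K) {z : OSIAlg K 2} (hz : z ∈ I) :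
    c • z ∈ I := by
  rw [Algebra.smul_def]
  exact I.mul_mem_left _ hz

/-- Proving p (a * z) for all a absorbs the ideal action into the generators, so p need not be
stable under left multiplication. -/
theorem P_induction {i : Fin 2} {p : OSIAlg K 2 → Prop} (h0 : p 0)
    (hadd : ∀ z w, p z → p w → p (z + w)) (hE : ∀ a k l, p (a * E K i k l)) {z : OSIAlg K 2}
    (hz : z ∈ P K i) : p z := by
  suffices h : ∀ a, p (a * z) by simpa using h 1
  induction hz using Submodule.span_induction with
  | mem z hz =>
    obtain ⟨q, rfl⟩ := hz
    exact fun a => hE a _ _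
  | zero => simpa using h0
  | add z w _ _ hz hw => exact fun a => by rw [mul_add]; exact hadd _ _ (hz a) (hw a)
  | smul b z _ hz => exact fun a => by rw [smul_eq_mul, ← mul_assoc]; exact hz _

theorem E_mul_E_mem_F2 (i : Fin 2) (k l p q : ℕ) : E K i k l * E K (i + 1) p q ∈ F2 K := by
  have h : ∀ k l p q : ℕ, E K (0 : Fin 2) k l * E K 1 p q ∈ F2 K := fun k l p q =>
    Submodule.subset_span ⟨![k, p], ![l, q], rfl⟩
  obtain rfl | rfl := fin_two_eq_or 0 i
  · exact h k l p q
  · rw [(commute_E_E K (ne_add_one _) k l p q).eq]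
    exact h p q k l

/-- On matrix units, x_i raises the row index and y_i lowers it or gives zero. -/
theorem mul_mem_F2_left (a : OSIAlg K 2) {z : OSIAlg K 2} (hz : z ∈ F2 K) : a * z ∈ F2 K := by
  have hgen : ∀ g : OSIAlg K 2, (∀ k l p q : ℕ, g * (E K (0 : Fin 2) k l * E K 1 p q) ∈ F2 K) →
      ∀ w ∈ F2 K, g * w ∈ F2 K := by
    intro g hg w hw
    induction hw using Submodule.span_induction with
    | mem w hw =>
      obtain ⟨α, β, rfl⟩ := hw
      exact hg _ _ _ _
    | zero => rw [mul_zero]; exact zero_mem _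
    | add w w' _ _ h h' => rw [mul_add]; exact add_mem h h'
    | smul c w _ h => rw [mul_smul_comm]; exact Submodule.smul_mem _ c h
  refine mul_mem_of_generators (fun i => hgen _ fun k l p q => ?_)
    (fun i => hgen _ fun k l p q => ?_) a z hz
  · obtain rfl | rfl := fin_two_eq_or 0 i
    · rw [← mul_assoc, x_mul_E]
      exact E_mul_E_mem_F2 0 _ _ _ _
    · rw [show E K (0 : Fin 2) k l * E K 1 p q = E K 1 p q * E K 0 k l from
        (commute_E_E K (ne_add_one 0) k l p q).eq, ← mul_assoc]
      change x K 1 * E K 1 p q * _ ∈ _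
      rw [x_mul_E]
      exact E_mul_E_mem_F2 1 _ _ _ _
  · obtain rfl | rfl := fin_two_eq_or 0 i
    · rw [← mul_assoc]
      cases k with
      | zero => rw [y_mul_E_zero, zero_mul]; exact zero_mem _
      | succ k => rw [y_mul_E_succ]; exact E_mul_E_mem_F2 0 _ _ _ _
    · rw [show E K (0 : Fin 2) k l * E K 1 p q = E K 1 p q * E K 0 k l from
        (commute_E_E K (ne_add_one 0) k l p q).eq, ← mul_assoc]
      change y K 1 * E K 1 p q * _ ∈ _
      cases p with
      | zero => rw [y_mul_E_zero, zero_mul]; exact zero_mem _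
      | succ p => rw [y_mul_E_succ]; exact E_mul_E_mem_F2 1 _ _ _ _

/-- The partial sums of the diagonal idempotents are local right units: they fix a E_kl(i) as soon
as m > l. -/
theorem exists_mul_sum_E {i : Fin 2} {z : OSIAlg K 2} (hz : z ∈ P K i) :
    ∃ n, ∀ m ≥ n, z * ∑ k ∈ Finset.range m, E K i k k = z := by
  refine P_induction (p := fun z => ∃ n, ∀ m ≥ n, z * ∑ k ∈ Finset.range m, E K i k k = z)
    ⟨0, fun _ _ => zero_mul _⟩ ?_ ?_ hz
  · rintro z w ⟨n, hn⟩ ⟨n', hn'⟩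
    exact ⟨max n n', fun m hm => by
      rw [add_mul, hn m (le_trans (le_max_left _ _) hm), hn' m (le_trans (le_max_right _ _) hm)]⟩
  · intro a k l
    refine ⟨l + 1, fun m hm => ?_⟩
    rw [mul_assoc, Finset.mul_sum, Finset.sum_eq_single l]
    · rw [E_mul_E, if_pos rfl]
    · intro b _ hb
      rw [E_mul_E, if_neg hb.symm]
    · intro h
      exact absurd (Finset.mem_range.2 (by omega)) h

/-- The intersection of the ideals `P i` is `F_2`. -/
theorem mem_F2_of_mem_P {i : Fin 2} {z : OSIAlg K 2} (hz : z ∈ P K i) (hz' : z ∈ P K (i + 1)) :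
    z ∈ F2 K := by
  obtain ⟨n, hn⟩ := exists_mul_sum_E hz
  -- Right multiplication by E_kk(i) turns a generator a E_pq(i+1) of the other ideal into a left
  -- multiple of E_kk(i) E_pq(i+1).
  rw [← hn n le_rfl, Finset.mul_sum]
  refine sum_mem fun k _ => ?_
  refine P_induction (p := fun z => z * E K i k k ∈ F2 K) ?_ ?_ ?_ hz'
  · rw [zero_mul]; exact zero_mem _
  · intro z w h h'
    rw [add_mul]; exact add_mem h h'
  · intro a p q
    rw [mul_assoc, ← (commute_E_E K (ne_add_one i) k k p q).eq]
    exact mul_mem_F2_left _ (E_mul_E_mem_F2 _ _ _ _ _)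

/-- Every element is a combination of monomials `x_i^k y_i^l x_j^b` modulo `P j`. -/
theorem exists_add_mem_span (i : Fin 2) (z : OSIAlg K 2) :
    ∃ p ∈ P K (i + 1), ∃ w ∈ Submodule.span K (Set.range fun q : ℕ × ℕ × ℤ =>
      x K i ^ q.1 * y K i ^ q.2.1 * xz (i + 1) q.2.2), p + w = z := by
  set V := Submodule.span K (Set.range fun q : ℕ × ℕ × ℤ =>
      x K i ^ q.1 * y K i ^ q.2.1 * xz (i + 1) q.2.2) with hV
  have hmem : ∀ k l b, x K i ^ k * y K i ^ l * xz (i + 1) b ∈ V := fun k l b =>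
    Submodule.subset_span ⟨(k, l, b), rfl⟩
  have hgen : ∀ g : OSIAlg K 2,
      (∀ k l b, g * (x K i ^ k * y K i ^ l * xz (i + 1) b) ∈
        (P K (i + 1)).restrictScalars K ⊔ V) →
      ∀ w ∈ (P K (i + 1)).restrictScalars K ⊔ V, g * w ∈ (P K (i + 1)).restrictScalars K ⊔ V := by
    intro g hg w hw
    obtain ⟨p, hp, v, hv, rfl⟩ := Submodule.mem_sup.1 hw
    rw [mul_add]
    refine add_mem (Submodule.mem_sup_left ?_) ?_
    · exact (P K (i + 1)).mul_mem_left g hp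
    · clear hw
      induction hv using Submodule.span_induction with
      | mem v hv =>
        obtain ⟨q, rfl⟩ := hv
        exact hg _ _ _
      | zero => rw [mul_zero]; exact zero_mem _
      | add v v' _ _ h h' => rw [mul_add]; exact add_mem h h'
      | smul c v _ h => rw [mul_smul_comm]; exact Submodule.smul_mem _ c h
  have hij := ne_add_one i
  have htop : (P K (i + 1)).restrictScalars K ⊔ V = ⊤ := by
    refine eq_top_of_generators (Submodule.mem_sup_right ?_) (fun m => hgen _ fun k l b => ?_)
      (fun m => hgen _ fun k l b => ?_)
    · simpa [xz_zero] using hmem 0 0 0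
    · obtain rfl | rfl := fin_two_eq_or i m
      · rw [← mul_assoc, ← mul_assoc, ← pow_succ']
        exact Submodule.mem_sup_right (hmem _ _ _)
      · have hc : Commute (x K (i + 1)) (x K i ^ k * y K i ^ l) :=
          ((commute_x_x K hij.symm).pow_right k).mul_right ((commute_x_y K hij.symm).pow_right l)
        rw [← mul_assoc, hc.eq, mul_assoc]
        obtain hb | hb := le_or_gt 0 b
        · rw [x_mul_xz_of_nonneg _ hb]
          exact Submodule.mem_sup_right (hmem _ _ _)
        · obtain ⟨c, rfl⟩ := Int.eq_negSucc_of_lt_zero hb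
          rw [show Int.negSucc c = -((c + 1 : ℕ) : ℤ) from rfl, x_mul_xz_of_neg, mul_sub]
          exact sub_mem (Submodule.mem_sup_right (hmem _ _ _)) (Submodule.mem_sup_left
            ((P K (i + 1)).mul_mem_left _ (E_mem_P _ _ _)))
    · refine Submodule.mem_sup_right ?_
      obtain rfl | rfl := fin_two_eq_or i m
      · rw [← mul_assoc, ← mul_assoc]
        cases k with
        | zero =>
          rw [pow_zero, mul_one, ← pow_succ']
          simpa using hmem 0 (l + 1) b
        | succ k =>
          rw [pow_succ', ← mul_assoc, y_mul_x, one_mul]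
          exact hmem _ _ _
      · have hc : Commute (y K (i + 1)) (x K i ^ k * y K i ^ l) :=
          ((commute_x_y K hij).symm.pow_right k).mul_right ((commute_y_y K hij.symm).pow_right l)
        rw [← mul_assoc, hc.eq, mul_assoc, y_mul_xz]
        exact hmem _ _ _
  obtain ⟨p, hp, w, hw, h⟩ := Submodule.mem_sup.1 (htop ▸ Submodule.mem_top (x := z))
  exact ⟨p, hp, w, hw, h⟩

/-- Every element is a combination of monomials `x_i^a x_j^b` modulo `P i + P j`. -/
theorem exists_add_mem_span' (i : Fin 2) (z : OSIAlg K 2) :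
    ∃ p ∈ P K i ⊔ P K (i + 1), ∃ w ∈ Submodule.span K (Set.range fun q : ℤ × ℤ =>
      xz i q.1 * xz (i + 1) q.2), p + w = z := by
  set V := Submodule.span K (Set.range fun q : ℤ × ℤ => xz (K := K) i q.1 * xz (i + 1) q.2) with hV
  have hmem : ∀ a b, xz i a * xz (i + 1) b ∈ V := fun a b =>
    Submodule.subset_span ⟨(a, b), rfl⟩
  have hij := ne_add_one i
  set I := P K i ⊔ P K (i + 1) with hI
  have hE : ∀ (m : Fin 2) (k l : ℕ), E K m k l ∈ I := by
    intro m k l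
    obtain rfl | rfl := fin_two_eq_or i m
    · exact Submodule.mem_sup_left (E_mem_P _ _ _)
    · exact Submodule.mem_sup_right (E_mem_P _ _ _)
  have hgen : ∀ g : OSIAlg K 2, (∀ a b, g * (xz i a * xz (i + 1) b) ∈ I.restrictScalars K ⊔ V) →
      ∀ w ∈ I.restrictScalars K ⊔ V, g * w ∈ I.restrictScalars K ⊔ V := by
    intro g hg w hw
    obtain ⟨p, hp, v, hv, rfl⟩ := Submodule.mem_sup.1 hw
    rw [mul_add]
    refine add_mem (Submodule.mem_sup_left ?_) ?_
    · exact I.mul_mem_left g hp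
    · clear hw
      induction hv using Submodule.span_induction with
      | mem v hv =>
        obtain ⟨q, rfl⟩ := hv
        exact hg _ _
      | zero => rw [mul_zero]; exact zero_mem _
      | add v v' _ _ h h' => rw [mul_add]; exact add_mem h h'
      | smul c v _ h => rw [mul_smul_comm]; exact Submodule.smul_mem _ c h
  have hx : ∀ (m : Fin 2) (b : ℤ), ∃ p ∈ I, x K m * xz m b = xz m (b + 1) - p := by
    intro m b
    obtain hb | hb := le_or_gt 0 b
    · exact ⟨0, zero_mem _, by rw [x_mul_xz_of_nonneg _ hb, sub_zero]⟩
    · obtain ⟨c, rfl⟩ := Int.eq_negSucc_of_lt_zero hb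
      refine ⟨E K m 0 c, hE _ _ _, ?_⟩
      rw [show Int.negSucc c = -((c + 1 : ℕ) : ℤ) from rfl, x_mul_xz_of_neg]
      push_cast
      rw [neg_add, neg_add_cancel_right]
  have hc : ∀ g : OSIAlg K 2, g = x K (i + 1) ∨ g = y K (i + 1) → ∀ a, Commute g (xz i a) := by
    rintro g (rfl | rfl) a
    · exact commute_xz i (commute_x_x K hij.symm) (commute_x_y K hij.symm) a
    · exact commute_xz i (commute_x_y K hij).symm (commute_y_y K hij.symm) a
  have hcc : ∀ a b, Commute (xz (K := K) i a) (xz (i + 1) b) := fun a b =>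
    commute_xz _ (hc _ (Or.inl rfl) a).symm (hc _ (Or.inr rfl) a).symm b
  have htop : I.restrictScalars K ⊔ V = ⊤ := by
    refine eq_top_of_generators (Submodule.mem_sup_right ?_) (fun m => hgen _ fun a b => ?_)
      (fun m => hgen _ fun a b => ?_)
    · simpa [xz_zero] using hmem 0 0
    · obtain rfl | rfl := fin_two_eq_or i m
      · obtain ⟨p, hp, h⟩ := hx m a
        have hxc : Commute (x K m) (xz (m + 1) b) :=
          commute_xz _ (commute_x_x K hij) (commute_x_y K hij) b
        rw [(hcc a b).eq, ← mul_assoc, hxc.eq, mul_assoc, h, mul_sub, ← (hcc (a + 1) b).eq]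
        exact sub_mem (Submodule.mem_sup_right (hmem _ _)) (Submodule.mem_sup_left
          (I.mul_mem_left _ hp))
      · obtain ⟨p, hp, h⟩ := hx (i + 1) b
        rw [← mul_assoc, (hc _ (Or.inl rfl) a).eq, mul_assoc, h, mul_sub]
        exact sub_mem (Submodule.mem_sup_right (hmem _ _)) (Submodule.mem_sup_left
          (I.mul_mem_left _ hp))
    · refine Submodule.mem_sup_right ?_
      obtain rfl | rfl := fin_two_eq_or i m
      · rw [← mul_assoc, y_mul_xz]
        exact hmem _ _
      · rw [← mul_assoc, (hc _ (Or.inr rfl) a).eq, mul_assoc, y_mul_xz]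
        exact hmem _ _
  obtain ⟨p, hp, w, hw, h⟩ := Submodule.mem_sup.1 (htop ▸ Submodule.mem_top (x := z))
  exact ⟨p, hp, w, hw, h⟩

end Structure

end OSI
/-! ### Shift operators -/

/-- A coordinate function with values in `ℕ` that can be changed freely. -/
structure NatCoord (ι : Type*) where
  get : ι → ℕ
  set : ι → ℕ → ι
  get_set : ∀ t n, get (set t n) = n
  set_set : ∀ t m n, set (set t m) n = set t n
  set_get : ∀ t, set t (get t) = t

namespace NatCoord

/-- The coordinate of `ℕ` itself. -/
def self : NatCoord ℕ := ⟨id, fun _ n => n, fun _ _ => rfl, fun _ _ _ => rfl, fun _ => rfl⟩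

/-- The first coordinate of a pair. -/
def fst : NatCoord (ℕ × ℕ) :=
  ⟨Prod.fst, fun t n => (n, t.2), fun _ _ => rfl, fun _ _ _ => rfl, fun _ => rfl⟩

/-- The second coordinate of a pair. -/
def snd : NatCoord (ℕ × ℕ) :=
  ⟨Prod.snd, fun t n => (t.1, n), fun _ _ => rfl, fun _ _ _ => rfl, fun _ => rfl⟩

variable {R : Type*} [CommRing R] {ι : Type*} (c : NatCoord ι)

theorem succ_injective : Function.Injective fun t => c.set t (c.get t + 1) := by
  intro t t' h
  have h1 := congrArg c.get h
  simp only [c.get_set] at h1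
  have h2 := congrArg (fun u => c.set u (c.get t)) h
  simp only [c.set_set] at h2
  rwa [c.set_get, Nat.succ_injective h1, c.set_get] at h2

/-- Raising the coordinate by one. -/
noncomputable def shift (R : Type*) [CommRing R] {ι : Type*} (c : NatCoord ι) : FinEnd R ι :=
  Finsupp.lmapDomain R R fun t => c.set t (c.get t + 1)

/-- Lowering the coordinate by one. -/
noncomputable def back (R : Type*) [CommRing R] {ι : Type*} (c : NatCoord ι) : FinEnd R ι :=
  Finsupp.lcomapDomain _ c.succ_injective

theorem back_apply (v : ι →₀ R) (t : ι) : c.back R v t = v (c.set t (c.get t + 1)) := rfl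

theorem shift_apply (v : ι →₀ R) (t : ι) :
    c.shift R v t = if c.get t = 0 then 0 else v (c.set t (c.get t - 1)) := by
  rw [shift, Finsupp.lmapDomain_apply]
  split_ifs with h
  · refine Finsupp.mapDomain_of_notMem_range _ _ ?_
    rintro ⟨u, rfl⟩
    simp only [c.get_set] at h
    omega
  · have ht : t = (fun t => c.set t (c.get t + 1)) (c.set t (c.get t - 1)) := by
      simp only [c.get_set, c.set_set]
      rw [Nat.sub_add_cancel (Nat.one_le_iff_ne_zero.2 h), c.set_get]
    conv_lhs => rw [ht]
    exact Finsupp.mapDomain_apply c.succ_injective _ _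

theorem back_mul_shift : c.back R * c.shift R = 1 := by
  refine LinearMap.ext fun v => Finsupp.ext fun t => ?_
  rw [Module.End.mul_apply, back_apply, shift_apply, c.get_set, c.set_set, if_neg (by omega),
    Nat.add_sub_cancel, c.set_get]
  rfl

theorem shift_pow_apply (k : ℕ) (v : ι →₀ R) (t : ι) :
    (c.shift R ^ k) v t = if c.get t < k then 0 else v (c.set t (c.get t - k)) := by
  induction k generalizing t with
  | zero => simp [c.set_get]
  | succ k ih =>
    rw [pow_succ', Module.End.mul_apply, shift_apply]
    split_ifs with h1 h2 h2
    · rfl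
    · omega
    · rw [ih, c.get_set, if_pos (by omega)]
    · rw [ih, c.get_set, if_neg (by omega), c.set_set, Nat.sub_sub, add_comm 1]

theorem back_pow_apply (k : ℕ) (v : ι →₀ R) (t : ι) :
    (c.back R ^ k) v t = v (c.set t (c.get t + k)) := by
  induction k generalizing t with
  | zero => simp [c.set_get]
  | succ k ih =>
    rw [pow_succ', Module.End.mul_apply, back_apply, ih, c.get_set, c.set_set]
    congr 2
    omega

theorem mul_apply_eq (k l : ℕ) (v : ι →₀ R) (t : ι) :
    (c.shift R ^ k * c.back R ^ l) v t =
      if c.get t < k then 0 else v (c.set t (c.get t - k + l)) := by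
  rw [Module.End.mul_apply, shift_pow_apply, back_pow_apply, c.get_set, c.set_set]

/-- Two coordinates that can be changed independently. -/
structure Indep (c c' : NatCoord ι) : Prop where
  get_left : ∀ t n, c.get (c'.set t n) = c.get t
  get_right : ∀ t n, c'.get (c.set t n) = c'.get t
  comm : ∀ t m n, c.set (c'.set t m) n = c'.set (c.set t n) m

variable {c} {c' : NatCoord ι}

theorem Indep.symm (h : Indep c c') : Indep c' c :=
  ⟨h.get_right, h.get_left, fun t m n => (h.comm t n m).symm⟩

theorem indep_fst_snd : Indep fst snd :=
  ⟨fun _ _ => rfl, fun _ _ => rfl, fun _ _ _ => rfl⟩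

theorem Indep.shift_shift (h : Indep c c') : c.shift R * c'.shift R = c'.shift R * c.shift R := by
  refine LinearMap.ext fun v => Finsupp.ext fun t => ?_
  simp only [Module.End.mul_apply, shift_apply, h.get_left, h.get_right, h.comm]
  split_ifs <;> rfl

theorem Indep.shift_back (h : Indep c c') : c.shift R * c'.back R = c'.back R * c.shift R := by
  refine LinearMap.ext fun v => Finsupp.ext fun t => ?_
  simp only [Module.End.mul_apply, shift_apply, back_apply, h.get_left, h.get_right, h.comm]

theorem Indep.back_back (h : Indep c c') : c.back R * c'.back R = c'.back R * c.back R := by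
  refine LinearMap.ext fun v => Finsupp.ext fun t => ?_
  simp only [Module.End.mul_apply, back_apply, h.get_left, h.get_right, h.comm]

end NatCoord

namespace OSI

/-! ### Representations of `𝕊_2` -/

section Representations

variable {K : Type*} [Field K]

section General

variable {n : ℕ} {R : Type*} [CommRing R] [Algebra K R] {ι : Type*}
  {f : OSIAlg K n →ₐ[K] FinEnd R ι} {i : Fin n} {c : NatCoord ι}

theorem map_sub_apply (f : OSIAlg K n →ₐ[K] FinEnd R ι) (a b : OSIAlg K n) (v : ι →₀ R) :
    f (a - b) v = f a v - f b v := by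
  rw [eq_sub_iff_add_eq, ← LinearMap.add_apply, ← map_add, sub_add_cancel]

theorem map_E_apply (hx : f (x K i) = c.shift R) (hy : f (y K i) = c.back R) (k l : ℕ)
    (v : ι →₀ R) (t : ι) : f (E K i k l) v t = if c.get t = k then v (c.set t l) else 0 := by
  rw [E, map_sub_apply, map_mul, map_mul, map_pow, map_pow, map_pow, map_pow, hx, hy,
    Finsupp.sub_apply, c.mul_apply_eq, c.mul_apply_eq]
  obtain h | h | h := lt_trichotomy (c.get t) k
  · rw [if_pos h, if_pos (by omega), if_neg (by omega), sub_zero]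
  · rw [if_neg (by omega), if_pos (by omega), if_pos h, h, Nat.sub_self, zero_add, sub_zero]
  · rw [if_neg (by omega), if_neg (by omega), if_neg (by omega),
      show c.get t - (k + 1) + (l + 1) = c.get t - k + l by omega, sub_self]

theorem map_xz_apply (hx : f (x K i) = c.shift R) (hy : f (y K i) = c.back R) (b : ℤ)
    (v : ι →₀ R) (t : ι) :
    f (xz i b) v t = if (c.get t : ℤ) < b then 0 else v (c.set t (c.get t - b).toNat) := by
  obtain ⟨b, rfl | rfl⟩ := b.eq_nat_or_neg
  · rw [xz_natCast, map_pow, hx, c.shift_pow_apply]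
    simp only [Nat.cast_lt]
    split_ifs
    · rfl
    · congr 2
      omega
  · rw [xz_neg_natCast, map_pow, hy, c.back_pow_apply, if_neg (by omega)]
    congr 2
    omega

end General

section General

variable {n : ℕ} {A : Type*} [Semiring A] [Algebra K A] {f : OSIAlg K n →ₐ[K] A} {i : Fin n}

/-- E_00 x = 0 always holds, so a right inverse of the image of x forces the image of E_00 to
vanish. -/
theorem map_E_eq_zero (h : f (x K i) * f (y K i) = 1) (k l : ℕ) : f (E K i k l) = 0 := by
  have h0 : f (E K i 0 0) = 0 := by
    rw [← mul_one (f (E K i 0 0)), ← h, ← mul_assoc, ← map_mul, E00_mul_x, map_zero, zero_mul]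
  rw [E_eq, map_mul, map_mul, h0, mul_zero, zero_mul]

theorem map_xz {u : ℤ → A} (h0 : u 0 = 1) (hadd : ∀ a b, u (a + b) = u a * u b)
    (hx : f (x K i) = u 1) (hy : f (y K i) = u (-1)) (b : ℤ) : f (xz i b) = u b := by
  have hp : ∀ (z : ℤ) (b : ℕ), u z ^ b = u (b * z) := by
    intro z b
    induction b with
    | zero => simp [h0]
    | succ b ih => rw [pow_succ, ih, ← hadd]; congr 1; push_cast; ring
  obtain ⟨b, rfl | rfl⟩ := b.eq_nat_or_neg
  · rw [xz_natCast, map_pow, hx, hp, mul_one]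
  · rw [xz_neg_natCast, map_pow, hy, hp]; congr 1; ring

theorem map_eq_zero_of_mem_P {A : Type*} [Semiring A] [Algebra K A] {f : OSIAlg K 2 →ₐ[K] A}
    {i : Fin 2} (h : f (x K i) * f (y K i) = 1) {z : OSIAlg K 2} (hz : z ∈ P K i) : f z = 0 := by
  refine P_induction (p := fun z => f z = 0) (map_zero f) ?_ ?_ hz
  · intro z w hz hw
    rw [map_add, hz, hw, add_zero]
  · intro a k l
    rw [map_mul, map_E_eq_zero h, mul_zero]

end General

section Rho

variable {R : Type*} [CommRing R] [Algebra K R] (t : Rˣ) (i : Fin 2)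

/-- The representation of `𝕊_2` on the free `R`-module on `ℕ` in which `x_i`, `y_i` are the
shifts and the other `x_j` acts as the unit `t`. -/
noncomputable def rhoUnit : OSIAlg K 2 →ₐ[K] FinEnd R ℕ :=
  lift (fun k => if k = i then NatCoord.self.shift _ else (t : R) • 1)
    (fun k => if k = i then NatCoord.self.back _ else ((t⁻¹ : Rˣ) : R) • 1)
    (by
      intro k
      split_ifs
      · exact NatCoord.back_mul_shift _
      · rw [smul_mul_smul_comm, one_mul, Units.inv_mul, one_smul])
    (by
      intro k l h
      split_ifs with h1 h2
      · exact absurd (h1.trans h2.symm) h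
      all_goals simp only [mul_smul_comm, smul_mul_assoc, mul_one, one_mul, smul_smul, mul_comm])
    (by
      intro k l h
      split_ifs with h1 h2
      · exact absurd (h1.trans h2.symm) h
      all_goals simp only [mul_smul_comm, smul_mul_assoc, mul_one, one_mul])
    (by
      intro k l h
      split_ifs with h1 h2
      · exact absurd (h1.trans h2.symm) h
      all_goals simp only [mul_smul_comm, smul_mul_assoc, mul_one, one_mul])

theorem rhoUnit_x : rhoUnit t i (x K i) = NatCoord.self.shift R := by
  rw [rhoUnit, lift_x, if_pos rfl]

theorem rhoUnit_y : rhoUnit t i (y K i) = NatCoord.self.back R := by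
  rw [rhoUnit, lift_y, if_pos rfl]

theorem rhoUnit_x' : rhoUnit t i (x K (i + 1)) = (t : R) • 1 := by
  rw [rhoUnit, lift_x, if_neg (ne_add_one i).symm]

theorem rhoUnit_y' : rhoUnit t i (y K (i + 1)) = ((t⁻¹ : Rˣ) : R) • 1 := by
  rw [rhoUnit, lift_y, if_neg (ne_add_one i).symm]

theorem rhoUnit_x'_mul_y' : rhoUnit t i (x K (i + 1)) * rhoUnit t i (y K (i + 1)) = 1 := by
  rw [rhoUnit_x', rhoUnit_y', smul_mul_smul_comm, one_mul, Units.mul_inv, one_smul]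

theorem rhoUnit_E (k l : ℕ) : rhoUnit t i (E K i k l) = matUnit R k l := by
  refine LinearMap.ext fun v => Finsupp.ext fun s => ?_
  rw [map_E_apply (rhoUnit_x t i) (rhoUnit_y t i), matUnit_apply, Finsupp.single_apply]
  simp only [NatCoord.self, id, eq_comm]

theorem rhoUnit_xz' (b : ℤ) : rhoUnit t i (xz (K := K) (i + 1) b) = ((t ^ b : Rˣ) : R) • 1 :=
  map_xz (u := fun b => ((t ^ b : Rˣ) : R) • 1) (by simp)
    (fun a b => by rw [smul_mul_smul_comm, one_mul, zpow_add, Units.val_mul])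
    (by rw [zpow_one, rhoUnit_x']) (by rw [zpow_neg_one, rhoUnit_y']) b

end Rho

open LaurentPolynomial

/-- The variable `T` as a unit of the Laurent polynomial ring. -/
noncomputable def unitT (K : Type*) [Field K] : K[T;T⁻¹]ˣ where
  val := T 1
  inv := T (-1)
  val_inv := by rw [← T_add, add_neg_cancel, T_zero]
  inv_val := by rw [← T_add, neg_add_cancel, T_zero]

theorem val_unitT_zpow (b : ℤ) : ((unitT K ^ b : K[T;T⁻¹]ˣ) : K[T;T⁻¹]) = T b := by
  obtain ⟨b, rfl | rfl⟩ := b.eq_nat_or_neg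
  · rw [zpow_natCast, Units.val_pow_eq_pow_val, unitT, T_pow, mul_one]
  · rw [zpow_neg, zpow_natCast, ← inv_pow, Units.val_pow_eq_pow_val]
    change T (-1) ^ b = _
    rw [T_pow, mul_neg_one]

/-- The representation of `𝕊_2` on the free `K[T;T⁻¹]`-module on `ℕ` in which `x_i`, `y_i` are the
shifts and the other `x_j` acts as `T`. -/
noncomputable abbrev rho (K : Type*) [Field K] (i : Fin 2) := rhoUnit (K := K) (unitT K) i

variable (i : Fin 2)

theorem rho_E (k l : ℕ) : rho K i (E K i k l) = matUnit _ k l := rhoUnit_E _ _ _ _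

theorem rho_E' (k l : ℕ) : rho K i (E K (i + 1) k l) = 0 :=
  map_E_eq_zero (rhoUnit_x'_mul_y' _ i) k l

theorem rho_xz' (b : ℤ) : rho K i (xz (i + 1) b) = (T b : K[T;T⁻¹]) • 1 := by
  rw [rhoUnit_xz', val_unitT_zpow]

theorem rho_eq_zero_of_mem_P {z : OSIAlg K 2} (hz : z ∈ P K (i + 1)) : rho K i z = 0 :=
  map_eq_zero_of_mem_P (rhoUnit_x'_mul_y' _ i) hz

theorem rho_xz_apply (b : ℤ) (v : ℕ →₀ K[T;T⁻¹]) (t : ℕ) :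
    rho K i (xz i b) v t = if (t : ℤ) < b then 0 else v (t - b).toNat :=
  map_xz_apply (rhoUnit_x _ i) (rhoUnit_y _ i) b v t

theorem rho_monomial_apply (k l : ℕ) (b : ℤ) (v : ℕ →₀ K[T;T⁻¹]) (t : ℕ) :
    rho K i (x K i ^ k * y K i ^ l * xz (i + 1) b) v t =
      if t < k then 0 else T b * v (t - k + l) := by
  rw [map_mul, rho_xz', mul_smul_comm, mul_one, LinearMap.smul_apply, Finsupp.smul_apply,
    map_mul, map_pow, map_pow, rhoUnit_x, rhoUnit_y, NatCoord.mul_apply_eq]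
  change T b • (if t < k then 0 else v (t - k + l)) = _
  split_ifs
  · rw [smul_zero]
  · rfl

/-- The kernel of `rho i` is contained in `P (i + 1)`. -/
theorem mem_P_of_rho_eq_zero {z : OSIAlg K 2} (hz : rho K i z = 0) : z ∈ P K (i + 1) := by
  obtain ⟨p, hp, w, hw, rfl⟩ := exists_add_mem_span i z
  rw [map_add, rho_eq_zero_of_mem_P i hp, zero_add] at hz
  obtain ⟨c, rfl⟩ := Finsupp.mem_span_range_iff_exists_finsupp.1 hw
  suffices hc : ∀ l k b, c (k, l, b) = 0 by
    have : c = 0 := Finsupp.ext fun q => hc _ _ _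
    simpa [this] using hp
  intro l
  induction l using Nat.strong_induction_on with
  | _ l ih =>
  intro k b
  -- The coefficient of T^b in the entry (k, l) only sees monomials with l' ≤ l. Those with l' < l
  -- have coefficient zero by induction, and l' = l forces k' = k.
  have h1 := congrArg (fun g : FinEnd K[T;T⁻¹] ℕ => ((g (Finsupp.single l 1)) k).coeff b) hz
  simp only [Finsupp.sum, map_sum, map_smul, LinearMap.sum_apply, Finsupp.finsetSum_apply,
    AddMonoidAlgebra.coeff_sum, LinearMap.smul_apply, Finsupp.smul_apply, LinearMap.zero_apply,
    Finsupp.zero_apply, AddMonoidAlgebra.coeff_smul, rho_monomial_apply,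
    AddMonoidAlgebra.coeff_zero] at h1
  rw [Finset.sum_eq_single (k, l, b)] at h1
  · simpa using h1
  · rintro ⟨k', l', b'⟩ _ hne
    simp only
    split_ifs with hk
    · simp
    · rw [Finsupp.single_apply]
      split_ifs with hl
      · obtain hl' | hl' := lt_or_eq_of_le (show l' ≤ l by omega)
        · rw [ih l' hl', zero_smul]
        · have hb : b' ≠ b := by
            rintro rfl
            exact hne (by rw [hl', show k' = k by omega])
          rw [mul_one, T_apply, if_neg hb, smul_zero]
      · simp
  · intro h
    rw [Finsupp.notMem_support_iff.1 h, zero_smul]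

/-- The homomorphism from `𝕊_2` to Laurent polynomials in two variables. -/
noncomputable def eps (K : Type*) [Field K] (i : Fin 2) : OSIAlg K 2 →ₐ[K] K[T;T⁻¹][T;T⁻¹] :=
  lift (fun k => if k = i then T 1 else C (T 1)) (fun k => if k = i then T (-1) else C (T (-1)))
    (by
      intro k
      split_ifs
      · rw [← T_add, neg_add_cancel, T_zero]
      · rw [← map_mul, ← T_add, neg_add_cancel, T_zero, map_one])
    (fun _ _ _ => mul_comm _ _) (fun _ _ _ => mul_comm _ _) (fun _ _ _ => mul_comm _ _)

theorem eps_x_mul_y (k : Fin 2) : eps K i (x K k) * eps K i (y K k) = 1 := by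
  rw [eps, lift_x, lift_y]
  split_ifs
  · rw [← T_add, add_neg_cancel, T_zero]
  · rw [← map_mul, ← T_add, add_neg_cancel, T_zero, map_one]

theorem eps_xz (b : ℤ) : eps K i (xz i b) = T b :=
  map_xz (by simp) T_add (by rw [eps, lift_x, if_pos rfl]) (by rw [eps, lift_y, if_pos rfl]) b

theorem eps_xz' (b : ℤ) : eps K i (xz (i + 1) b) = C (T b) :=
  map_xz (u := fun b => C (T b)) (by simp) (fun a b => by rw [T_add, map_mul])
    (by rw [eps, lift_x, if_neg (ne_add_one i).symm])
    (by rw [eps, lift_y, if_neg (ne_add_one i).symm]) b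

theorem eps_eq_zero_of_mem_P {k : Fin 2} {z : OSIAlg K 2} (hz : z ∈ P K k) : eps K i z = 0 :=
  map_eq_zero_of_mem_P (eps_x_mul_y i k) hz

/-- The kernel of `eps` is contained in `P i + P (i + 1)`. -/
theorem mem_sup_P_of_eps_eq_zero {z : OSIAlg K 2} (hz : eps K i z = 0) :
    z ∈ P K i ⊔ P K (i + 1) := by
  obtain ⟨p, hp, w, hw, rfl⟩ := exists_add_mem_span' i z
  have hp0 : eps K i p = 0 := by
    obtain ⟨a, ha, b, hb, rfl⟩ := Submodule.mem_sup.1 hp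
    rw [map_add, eps_eq_zero_of_mem_P i ha, eps_eq_zero_of_mem_P i hb, add_zero]
  rw [map_add, hp0, zero_add] at hz
  obtain ⟨c, rfl⟩ := Finsupp.mem_span_range_iff_exists_finsupp.1 hw
  suffices hc : ∀ a b, c (a, b) = 0 by
    have : c = 0 := Finsupp.ext fun q => hc _ _
    simpa [this] using hp
  intro a b
  have hmon : ∀ a' b' : ℤ, ((eps K i (xz i a' * xz (i + 1) b')).coeff a).coeff b =
      if a' = a ∧ b' = b then 1 else 0 := by
    intro a' b'
    rw [map_mul, eps_xz, eps_xz', mul_comm, ← single_eq_C_mul_T, AddMonoidAlgebra.coeff_single,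
      Finsupp.single_apply]
    by_cases h : a' = a <;> simp [h]
  have h1 := congrArg (fun g : K[T;T⁻¹][T;T⁻¹] => (g.coeff a).coeff b) hz
  simp only [Finsupp.sum, map_sum, map_smul, Finsupp.finsetSum_apply,
    AddMonoidAlgebra.coeff_sum, Finsupp.smul_apply,
    Finsupp.zero_apply, AddMonoidAlgebra.coeff_smul, hmon,
    AddMonoidAlgebra.coeff_zero] at h1
  rw [Finset.sum_eq_single (a, b)] at h1
  · simpa using h1
  · rintro ⟨a', b'⟩ _ hne
    rw [if_neg (by simpa using hne), smul_zero]
  · intro h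
    rw [Finsupp.notMem_support_iff.1 h, zero_smul]

/-- The representation of `𝕊_2` on `K[x_1, x_2]`, with the exponent of `x_i` as first coordinate. -/
noncomputable def tau (K : Type*) [Field K] (i : Fin 2) : OSIAlg K 2 →ₐ[K] FinEnd K (ℕ × ℕ) :=
  lift (fun k => (if k = i then NatCoord.fst else NatCoord.snd).shift K)
    (fun k => (if k = i then NatCoord.fst else NatCoord.snd).back K)
    (fun k => NatCoord.back_mul_shift _)
    (by
      intro k l h
      refine NatCoord.Indep.shift_back ?_
      split_ifs with h1 h2 h2
      · exact absurd (h1.trans h2.symm) h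
      · exact NatCoord.indep_fst_snd
      · exact NatCoord.indep_fst_snd.symm
      · exact absurd (((fin_two_eq_or i k).resolve_left h1).trans
          ((fin_two_eq_or i l).resolve_left h2).symm) h)
    (by
      intro k l h
      refine NatCoord.Indep.shift_shift ?_
      split_ifs with h1 h2 h2
      · exact absurd (h1.trans h2.symm) h
      · exact NatCoord.indep_fst_snd
      · exact NatCoord.indep_fst_snd.symm
      · exact absurd (((fin_two_eq_or i k).resolve_left h1).trans
          ((fin_two_eq_or i l).resolve_left h2).symm) h)
    (by
      intro k l h
      refine NatCoord.Indep.back_back ?_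
      split_ifs with h1 h2 h2
      · exact absurd (h1.trans h2.symm) h
      · exact NatCoord.indep_fst_snd
      · exact NatCoord.indep_fst_snd.symm
      · exact absurd (((fin_two_eq_or i k).resolve_left h1).trans
          ((fin_two_eq_or i l).resolve_left h2).symm) h)

theorem tau_x : tau K i (x K i) = NatCoord.fst.shift K := by
  rw [tau, lift_x, if_pos rfl]

theorem tau_y : tau K i (y K i) = NatCoord.fst.back K := by
  rw [tau, lift_y, if_pos rfl]

theorem tau_x' : tau K i (x K (i + 1)) = NatCoord.snd.shift K := by
  rw [tau, lift_x, if_neg (ne_add_one i).symm]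

theorem tau_y' : tau K i (y K (i + 1)) = NatCoord.snd.back K := by
  rw [tau, lift_y, if_neg (ne_add_one i).symm]

theorem tau_E_apply (k l : ℕ) (v : ℕ × ℕ →₀ K) (p q : ℕ) :
    tau K i (E K i k l) v (p, q) = if p = k then v (l, q) else 0 :=
  map_E_apply (tau_x i) (tau_y i) k l v (p, q)

theorem tau_E'_apply (k l : ℕ) (v : ℕ × ℕ →₀ K) (p q : ℕ) :
    tau K i (E K (i + 1) k l) v (p, q) = if q = k then v (p, l) else 0 :=
  map_E_apply (tau_x' i) (tau_y' i) k l v (p, q)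

theorem tau_xz'_apply (b : ℤ) (v : ℕ × ℕ →₀ K) (p q : ℕ) :
    tau K i (xz (i + 1) b) v (p, q) = if (q : ℤ) < b then 0 else v (p, (q - b).toNat) :=
  map_xz_apply (tau_x' i) (tau_y' i) b v (p, q)

theorem tau_E_mul_E (k l p q : ℕ) :
    tau K i (E K i k l * E K (i + 1) p q) = matUnit K (k, p) (l, q) := by
  refine LinearMap.ext fun v => Finsupp.ext fun ⟨s, t⟩ => ?_
  rw [map_mul, Module.End.mul_apply, tau_E_apply, tau_E'_apply, matUnit_apply,
    Finsupp.single_apply]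
  simp only [Prod.mk.injEq, eq_comm (a := k), eq_comm (a := p)]
  by_cases h1 : s = k <;> by_cases h2 : t = p <;> simp [h1, h2]

end Representations

end OSI
/-! ### Diagonal units -/

/-- The diagonal matrix with the unit `d` at `a` and `1` elsewhere. -/
noncomputable def diagHom {R : Type*} [CommRing R] {ι : Type*} (a : ι) :
    Rˣ →* (FinEnd R ι)ˣ :=
  MonoidHom.toHomUnits
    { toFun := fun d => 1 + ((d : R) - 1) • matUnit R a a
      map_one' := by simp
      map_mul' := fun c d => by
        classical
        rw [add_mul, one_mul, mul_add, mul_one, smul_mul_smul_comm, matUnit_mul,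
          if_pos rfl, add_assoc, ← add_smul, ← add_smul]
        congr 2
        push_cast
        ring }

theorem val_diagHom {R : Type*} [CommRing R] {ι : Type*} (a : ι) (d : Rˣ) :
    (diagHom a d : FinEnd R ι) = 1 + ((d : R) - 1) • matUnit R a a := rfl

namespace OSI

open LaurentPolynomial

/-! ### Units under `rho`: lifting elementary operations and reducing to a diagonal entry. -/

section UnitsOf

variable {K : Type*} [Field K]

/-- The action of `rho i` on units. -/
noncomputable def rhoU (K : Type*) [Field K] (i : Fin 2) :
    (OSIAlg K 2)ˣ →* (FinEnd K[T;T⁻¹] ℕ)ˣ :=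
  Units.map (rho K i : OSIAlg K 2 →* FinEnd K[T;T⁻¹] ℕ)

theorem val_rhoU (i : Fin 2) (u : (OSIAlg K 2)ˣ) : (rhoU K i u : FinEnd _ ℕ) = rho K i u := rfl

theorem x_mem_y_mem_S1 (i : Fin 2) : x K i ∈ S1 K i ∧ y K i ∈ S1 K i :=
  ⟨Algebra.subset_adjoin (by simp), Algebra.subset_adjoin (by simp)⟩

theorem xz_mem_S1 (i : Fin 2) (b : ℤ) : xz i b ∈ S1 K i := by
  cases b with
  | ofNat b => exact pow_mem (x_mem_y_mem_S1 i).1 b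
  | negSucc b => exact pow_mem (x_mem_y_mem_S1 i).2 (b + 1)

theorem val_mu (i : Fin 2) (c : Kˣ) :
    (mu K i c : OSIAlg K 2) = 1 + ((c : K) - 1) • E K i 0 0 := by
  change (c : K) • E K i 0 0 + 1 - E K i 0 0 = _
  rw [sub_smul, one_smul]
  abel

theorem val_elementary {i j : Fin 2} (h : i ≠ j) (a : S1 K j) {k l : ℕ} (hkl : k ≠ l) :
    (elementary K h a hkl : OSIAlg K 2) = 1 + a * E K i k l := rfl

theorem elementary_mem_EInf (i : Fin 2) (a : S1 K (i + 1)) {k l : ℕ} (hkl : k ≠ l) :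
    elementary K (ne_add_one i) a hkl ∈ EInf K i :=
  Subgroup.subset_closure ⟨a, k, l, hkl, rfl⟩

theorem smul_eq_C_smul (r : K) (A : FinEnd K[T;T⁻¹] ℕ) : r • A = (C r : K[T;T⁻¹]) • A := by
  rw [C_eq_algebraMap, algebraMap_smul]

theorem rhoU_mu (i : Fin 2) (c : Kˣ) :
    rhoU K i (mu K i c) = diagHom 0 (Units.map (C : K →+* K[T;T⁻¹]).toMonoidHom c) := by
  refine Units.ext ?_
  rw [val_rhoU, val_mu, val_diagHom, map_add, map_one, map_smul, rho_E, smul_eq_C_smul]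
  simp

theorem rhoU_mu' (i : Fin 2) (c : Kˣ) : rhoU K i (mu K (i + 1) c) = 1 := by
  refine Units.ext ?_
  rw [val_rhoU, val_mu, map_add, map_one, map_smul, rho_E', smul_zero, add_zero, Units.val_one]

theorem exists_rho_eq_smul_one (i : Fin 2) {a : OSIAlg K 2} (ha : a ∈ S1 K (i + 1)) :
    ∃ f : K[T;T⁻¹], rho K i a = f • 1 := by
  induction ha using Algebra.adjoin_induction with
  | mem z hz =>
    rcases hz with rfl | rfl
    · exact ⟨_, rhoUnit_x' _ _⟩
    · exact ⟨_, rhoUnit_y' _ _⟩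
  | algebraMap r =>
    refine ⟨C r, ?_⟩
    rw [AlgHom.commutes, Algebra.algebraMap_eq_smul_one, smul_eq_C_smul]
  | add a b _ _ ha hb =>
    obtain ⟨f, hf⟩ := ha
    obtain ⟨g, hg⟩ := hb
    exact ⟨f + g, by rw [map_add, hf, hg, add_smul]⟩
  | mul a b _ _ ha hb =>
    obtain ⟨f, hf⟩ := ha
    obtain ⟨g, hg⟩ := hb
    exact ⟨f * g, by rw [map_mul, hf, hg, smul_mul_smul_comm, one_mul]⟩

theorem exists_mem_S1_rho_eq (i : Fin 2) (f : K[T;T⁻¹]) :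
    ∃ a : S1 K (i + 1), rho K i a = f • 1 := by
  induction f using LaurentPolynomial.induction_on' with
  | add f g hf hg =>
    obtain ⟨a, ha⟩ := hf
    obtain ⟨b, hb⟩ := hg
    exact ⟨a + b, by rw [Subalgebra.coe_add, map_add, ha, hb, add_smul]⟩
  | C_mul_T n r =>
    refine ⟨r • ⟨xz (i + 1) n, xz_mem_S1 _ _⟩, ?_⟩
    rw [Subalgebra.coe_smul, map_smul, rho_xz', smul_eq_C_smul, smul_smul]

theorem rhoU_elementary (i : Fin 2) {a : S1 K (i + 1)} {f : K[T;T⁻¹]} (h : rho K i a = f • 1)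
    {k l : ℕ} (hkl : k ≠ l) :
    rhoU K i (elementary K (ne_add_one i) a hkl) = endTransvection hkl f := by
  refine Units.ext ?_
  rw [val_rhoU, val_elementary, map_add, map_one, map_mul, h, rho_E, smul_mul_assoc, one_mul]
  rfl

theorem rhoU_mem_endElementary (i : Fin 2) {g : (OSIAlg K 2)ˣ} (hg : g ∈ EInf K i) :
    rhoU K i g ∈ endElementary K[T;T⁻¹] ℕ := by
  have : EInf K i ≤ (endElementary K[T;T⁻¹] ℕ).comap (rhoU K i) := by
    refine (Subgroup.closure_le _).2 ?_
    rintro _ ⟨a, k, l, hkl, rfl⟩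
    obtain ⟨f, hf⟩ := exists_rho_eq_smul_one i a.2
    rw [SetLike.mem_coe, Subgroup.mem_comap, rhoU_elementary i hf]
    exact endTransvection_mem _ _
  exact this hg

/-- Every Laurent polynomial is the scalar by which some element of 𝕊_1(i+1) acts, so all row and
column operations lift to 𝕊_2. -/
theorem endElementary_le_map_EInf (i : Fin 2) :
    endElementary K[T;T⁻¹] ℕ ≤ (EInf K i).map (rhoU K i) := by
  refine (Subgroup.closure_le _).2 ?_
  rintro _ ⟨k, l, hkl, f, rfl⟩
  obtain ⟨a, ha⟩ := exists_mem_S1_rho_eq i f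
  exact ⟨_, elementary_mem_EInf i a hkl, rhoU_elementary i ha hkl⟩

theorem rhoU_EInf' (i : Fin 2) {g : (OSIAlg K 2)ˣ} (hg : g ∈ EInf K (i + 1)) :
    rhoU K i g = 1 := by
  have : EInf K (i + 1) ≤ (rhoU K i).ker := by
    refine (Subgroup.closure_le _).2 ?_
    rintro _ ⟨a, k, l, hkl, rfl⟩
    refine Units.ext ?_
    rw [val_rhoU, val_elementary, map_add, map_one, map_mul, rho_E', mul_zero, add_zero,
      Units.val_one]
  exact this hg

/-- The image of an element of `P i` under `rho i` is a finite matrix. -/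
theorem exists_finset_rho (i : Fin 2) {z : OSIAlg K 2} (hz : z ∈ P K i) :
    ∃ s : Finset ℕ, (∀ j ∉ s, rho K i z (Finsupp.single j 1) = 0) ∧
      ∀ k ∉ s, ∀ v, rho K i z v k = 0 := by
  refine P_induction (p := fun z => ∃ s : Finset ℕ,
    (∀ j ∉ s, rho K i z (Finsupp.single j 1) = 0) ∧ ∀ k ∉ s, ∀ v, rho K i z v k = 0) ?_ ?_ ?_ hz
  · exact ⟨∅, fun _ _ => by rw [map_zero]; rfl, fun _ _ _ => by rw [map_zero]; rfl⟩
  · rintro z w ⟨s, h1, h2⟩ ⟨t, h3, h4⟩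
    refine ⟨s ∪ t, fun j hj => ?_, fun k hk v => ?_⟩
    · rw [Finset.notMem_union] at hj
      rw [map_add, LinearMap.add_apply, h1 j hj.1, h3 j hj.2, add_zero]
    · rw [Finset.notMem_union] at hk
      rw [map_add, LinearMap.add_apply, Finsupp.add_apply, h2 k hk.1, h4 k hk.2, add_zero]
  · intro a k l
    refine ⟨insert l (rho K i a (Finsupp.single k 1)).support, fun j hj => ?_, fun m hm v => ?_⟩
    · have : j ≠ l := by rintro rfl; exact hj (Finset.mem_insert_self _ _)
      rw [map_mul, Module.End.mul_apply, rho_E, matUnit_apply, Finsupp.single_apply, if_neg this,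
        Finsupp.single_zero, map_zero]
    · have h0 : rho K i a (Finsupp.single k 1) m = 0 :=
        Finsupp.notMem_support_iff.1 fun h => hm (Finset.mem_insert_of_mem h)
      rw [map_mul, Module.End.mul_apply, rho_E, matUnit_apply,
        show Finsupp.single k (v l) = v l • Finsupp.single k (1 : K[T;T⁻¹]) by simp, map_smul,
        Finsupp.smul_apply, h0, smul_zero]

theorem sup_P_eq (i : Fin 2) : P K i ⊔ P K (i + 1) = P K 0 ⊔ P K 1 := by
  obtain rfl | rfl := fin_two_eq_or 0 i
  · rfl
  · exact sup_comm _ _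

theorem exists_isBlock_rhoU (i : Fin 2) {u : (OSIAlg K 2)ˣ}
    (hu : (u : OSIAlg K 2) - 1 ∈ P K 0 ⊔ P K 1) :
    ∃ s, IsBlock s (rhoU K i u : FinEnd K[T;T⁻¹] ℕ) := by
  rw [← sup_P_eq i] at hu
  obtain ⟨p, hp, q, hq, h⟩ := Submodule.mem_sup.1 hu
  obtain ⟨s, h1, h2⟩ := exists_finset_rho i hp
  have hru : rho K i u = 1 + rho K i p := by
    rw [← sub_add_cancel (u : OSIAlg K 2) 1, ← h, map_add, map_add, rho_eq_zero_of_mem_P i hq,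
      add_zero, map_one, add_comm]
  refine ⟨s, fun j hj => ?_, fun k hk v => ?_⟩
  · rw [val_rhoU, hru, LinearMap.add_apply, h1 j hj, add_zero]; rfl
  · rw [val_rhoU, hru, LinearMap.add_apply, Finsupp.add_apply, h2 k hk, add_zero]; rfl

/-- Elementary reduction of a unit which is trivial modulo `P 0 + P 1`. -/
theorem exists_rhoU_eq_diag (i : Fin 2) {u : (OSIAlg K 2)ˣ}
    (hu : (u : OSIAlg K 2) - 1 ∈ P K 0 ⊔ P K 1) :
    ∃ g ∈ EInf K i, ∃ g' ∈ EInf K i, ∃ c : Kˣ, ∃ m : ℤ,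
      rhoU K i (g * u * g') = rhoU K i (mu K i c) * diagHom 0 (unitT K ^ m) := by
  obtain ⟨s, hs⟩ := exists_isBlock_rhoU i hu
  obtain ⟨N, hN⟩ := exists_euclidean K
  -- Erasing and reinserting 0 makes it the pivot whether or not it lies in s, so that the diagonal
  -- entry matches `mu` at E_00.
  obtain ⟨g, hg, g', hg', d, hd⟩ := exists_elementary_reduction hN 0 (s.erase 0)
    (Finset.notMem_erase _ _) (rhoU K i u)
    (hs.mono fun k hk => by by_cases h : k = 0 <;> simp [h, hk])
  obtain ⟨g, hgE, rfl⟩ := endElementary_le_map_EInf i hg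
  obtain ⟨g', hgE', rfl⟩ := endElementary_le_map_EInf i hg'
  obtain ⟨c, m, hcm⟩ := exists_eq_C_mul_T_of_isUnit d.isUnit
  refine ⟨g, hgE, g', hgE', c, m, ?_⟩
  rw [map_mul, map_mul, rhoU_mu, ← map_mul (diagHom 0)]
  refine Units.ext ?_
  rw [hd, val_diagHom]
  congr 3
  rw [hcm, Units.val_mul, val_unitT_zpow]
  rfl

/-- Conjugation by diag(d_0, d_1, ...) multiplies the entry (k, l) by d_k / d_l; here d_0 = c and
the other d are 1. -/
theorem mu_mul_elementary (i : Fin 2) (c : Kˣ) (a : S1 K (i + 1)) {k l : ℕ} (hkl : k ≠ l) :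
    ∃ a' : S1 K (i + 1), mu K i c * elementary K (ne_add_one i) a hkl =
      elementary K (ne_add_one i) a' hkl * mu K i c := by
  have hl : (mu K i c : OSIAlg K 2) * E K i k l = (if k = 0 then (c : K) else 1) • E K i k l := by
    rw [val_mu, add_mul, one_mul, smul_mul_assoc, E_mul_E]
    split_ifs with h1 h2 h2
    · rw [← h1, sub_smul, one_smul]; abel
    · exact absurd h1.symm h2
    · exact absurd h2.symm h1
    · rw [smul_zero, one_smul, add_zero]
  have hr : E K i k l * (mu K i c : OSIAlg K 2) = (if l = 0 then (c : K) else 1) • E K i k l := by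
    rw [val_mu, mul_add, mul_one, mul_smul_comm, E_mul_E]
    split_ifs with h1
    · subst h1; rw [sub_smul, one_smul]; abel
    · rw [smul_zero, one_smul, add_zero]
  have hc : Commute (mu K i c : OSIAlg K 2) a := by
    rw [val_mu]
    exact (Commute.one_left _).add_left ((commute_S1_E K (ne_add_one i) a 0 0).symm.smul_left _)
  have hne : (if l = 0 then (c : K) else 1) ≠ 0 := by split_ifs <;> simp
  refine ⟨((if l = 0 then (c : K) else 1)⁻¹ * if k = 0 then (c : K) else 1) • a, Units.ext ?_⟩
  rw [Units.val_mul, Units.val_mul, val_elementary, val_elementary, mul_add, add_mul, mul_one,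
    one_mul, Subalgebra.coe_smul, mul_assoc, hr, ← mul_assoc, hc.eq, mul_assoc, hl,
    mul_smul_comm, smul_mul_assoc, mul_smul_comm, smul_smul, mul_right_comm, inv_mul_cancel₀ hne,
    one_mul]

theorem conj_mu_mem_EInf (i : Fin 2) (c : Kˣ) {g : (OSIAlg K 2)ˣ} (hg : g ∈ EInf K i) :
    mu K i c * g * (mu K i c)⁻¹ ∈ EInf K i := by
  have : EInf K i ≤ (EInf K i).comap (MulAut.conj (mu K i c)).toMonoidHom := by
    conv_lhs => rw [EInf]
    refine (Subgroup.closure_le _).2 ?_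
    rintro _ ⟨a, k, l, hkl, rfl⟩
    obtain ⟨a', ha'⟩ := mu_mul_elementary i c a hkl
    change mu K i c * _ * (mu K i c)⁻¹ ∈ EInf K i
    rw [ha', mul_inv_cancel_right]
    exact elementary_mem_EInf i a' hkl
  exact this hg

/-! ### Commutators of 2 × 2 blocks over 𝕊_1(i+1). -/

section Block

variable (i : Fin 2)

/-- A `2 × 2` matrix over `𝕊_1(i+1)`, placed in the upper left corner. -/
noncomputable def block (M : Matrix (Fin 2) (Fin 2) (S1 K (i + 1))) : OSIAlg K 2 :=
  ∑ k : Fin 2, ∑ l : Fin 2, (M k l : OSIAlg K 2) * E K i k l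

theorem block_mul (M N : Matrix (Fin 2) (Fin 2) (S1 K (i + 1))) :
    block i (M * N) = block i M * block i N := by
  have h : ∀ k l p q : Fin 2, (M k l : OSIAlg K 2) * E K i k l * (N p q * E K i p q) =
      if l = p then (M k l : OSIAlg K 2) * N p q * E K i k q else 0 := by
    intro k l p q
    rw [mul_assoc, ← mul_assoc (E K i k l), ← (commute_S1_E K (ne_add_one i) (N p q) k l).eq,
      mul_assoc (N p q : OSIAlg K 2), E_mul_E]
    simp only [Fin.val_inj]
    split_ifs
    · rw [mul_assoc]
    · rw [mul_zero, mul_zero]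
  simp only [block, Finset.sum_mul, Finset.mul_sum, h, Matrix.mul_apply]
  simp [Fin.sum_univ_two, add_mul]
  abel

/-- A `2 × 2` matrix over `𝕊_1(i+1)`, completed by the identity. -/
noncomputable def blockHom : Matrix (Fin 2) (Fin 2) (S1 K (i + 1)) →* OSIAlg K 2 where
  toFun M := block i M + (1 - block i 1)
  map_one' := add_sub_cancel _ _
  map_mul' M N := by
    have h1 := block_mul i M 1
    have h2 := block_mul i 1 N
    have h3 := block_mul (K := K) i 1 1
    rw [mul_one] at h1 h3
    rw [one_mul] at h2
    rw [add_mul, mul_add, mul_add, ← block_mul, mul_sub, mul_one, ← h1, sub_mul, one_mul, ← h2,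
      mul_sub, mul_one, sub_mul, ← h3]
    simp

theorem blockHom_apply (a b c d : S1 K (i + 1)) :
    blockHom i !![a, b; c, d] = 1 + (((a : OSIAlg K 2) - 1) * E K i 0 0 + b * E K i 0 1 +
      c * E K i 1 0 + (d - 1) * E K i 1 1) := by
  simp [blockHom, block, Fin.sum_univ_two, sub_mul]
  abel

/-- `1 + (c - 1) E_{11}(i) E_{00}(i+1)` is a product of elementary matrices. -/
theorem exists_mem_EInf_eq (c : Kˣ) : ∃ g ∈ EInf K i,
    (g : OSIAlg K 2) = 1 + ((c : K) - 1) • (E K i 1 1 * E K (i + 1) 0 0) := by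
  set X : S1 K (i + 1) := ⟨x K (i + 1), (x_mem_y_mem_S1 _).1⟩ with hX
  set Y : S1 K (i + 1) := ⟨y K (i + 1), (x_mem_y_mem_S1 _).2⟩ with hY
  have hYX : Y * X = 1 := Subtype.ext (y_mul_x K (i + 1))
  have h01 : ∀ a : S1 K (i + 1), ∃ g ∈ EInf K i, (g : OSIAlg K 2) = blockHom i !![1, a; 0, 1] :=
    fun a => ⟨_, elementary_mem_EInf i a zero_ne_one, by
      rw [blockHom_apply, val_elementary]; simp⟩
  have h10 : ∀ a : S1 K (i + 1), ∃ g ∈ EInf K i, (g : OSIAlg K 2) = blockHom i !![1, 0; a, 1] :=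
    fun a => ⟨_, elementary_mem_EInf i a one_ne_zero, by
      rw [blockHom_apply, val_elementary]; simp⟩
  obtain ⟨g₁, hg₁, h₁⟩ := h01 Y
  obtain ⟨g₂, hg₂, h₂⟩ := h10 (-X)
  obtain ⟨g₃, hg₃, h₃⟩ := h01 (-1)
  obtain ⟨g₄, hg₄, h₄⟩ := h10 1
  -- Whitehead's factorisation of diag(Y, Y⁻¹) with X in place of Y⁻¹. As only YX = 1 holds, the
  -- corner entry 1 - XY survives.
  set W := g₁ * g₂ * g₁ * (g₃ * g₄ * g₃) with hWdef
  have hWmem : W ∈ EInf K i :=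
    mul_mem (mul_mem (mul_mem hg₁ hg₂) hg₁) (mul_mem (mul_mem hg₃ hg₄) hg₃)
  have hW : (W : OSIAlg K 2) = blockHom i !![Y, 0; 1 - X * Y, X] := by
    rw [hWdef]
    simp only [Units.val_mul, h₁, h₂, h₃, h₄, ← map_mul (blockHom i), Matrix.mul_fin_two]
    congr 1
    ext a b
    fin_cases a <;> fin_cases b <;> simp [hYX, sub_eq_add_neg, add_comm]
  have hd : (mu K i c : OSIAlg K 2) = blockHom i !![(c : K) • 1, 0; 0, 1] := by
    rw [blockHom_apply, val_mu]
    simp [sub_smul, sub_mul]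
  -- The commutator of W with diag(c, 1) would be trivial for invertible X. Here it is diag(1, 1 +
  -- (c - 1)(1 - XY)), and 1 - XY = E_00(i+1). It is elementary because `mu K i c` normalises `EInf
  -- K i`.
  refine ⟨W * (mu K i c * W⁻¹ * (mu K i c)⁻¹), mul_mem hWmem (conj_mu_mem_EInf i c
    (inv_mem hWmem)), ?_⟩
  have hr : 1 + ((c : K) - 1) • (E K i 1 1 * E K (i + 1) 0 0) =
      blockHom i !![1, 0; 0, 1 + ((c : K) - 1) • (1 - X * Y)] := by
    rw [blockHom_apply]
    have : E K (i + 1) 0 0 = ((1 - X * Y : S1 K (i + 1)) : OSIAlg K 2) := by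
      rw [E00_eq]; rfl
    rw [this, ← (commute_S1_E K (ne_add_one i) (1 - X * Y) 1 1).eq]
    simp
  rw [hr, ← mul_assoc, ← mul_assoc, Units.val_mul, Units.val_mul, Units.mul_inv_eq_iff_eq_mul,
    Units.mul_inv_eq_iff_eq_mul, Units.val_mul, hW, hd, ← map_mul (blockHom i),
    ← map_mul (blockHom i), ← map_mul (blockHom i)]
  congr 1
  have hXYX : X * (Y * X) = X := by rw [hYX, mul_one]
  have hYXY : Y * (X * Y) = Y := by rw [← mul_assoc, hYX, one_mul]
  ext a b
  fin_cases a <;> fin_cases b <;>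
    simp [Matrix.mul_apply, Fin.sum_univ_two, sub_smul, mul_sub, sub_mul, add_mul, mul_assoc, hXYX,
      hYXY]
  generalize (c : K) • (1 - (X : OSIAlg K 2) * (Y : OSIAlg K 2)) = Z
  abel

end Block

end UnitsOf

end OSI
-- The group (1+F_2)^* as finitary matrices over K.
namespace OSI

open LaurentPolynomial

section FTwo

variable {K : Type*} [Field K] (i : Fin 2)

theorem F2_le_P {z : OSIAlg K 2} (hz : z ∈ F2 K) : z ∈ P K i := by
  induction hz using Submodule.span_induction with
  | mem z hz =>
    obtain ⟨α, β, rfl⟩ := hz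
    obtain rfl | rfl := fin_two_eq_or 0 i
    · have h := (commute_E_E K (ne_add_one 0) (α 0) (β 0) (α 1) (β 1)).eq
      exact h ▸ (P K 0).mul_mem_left _ (E_mem_P _ _ _)
    · exact (P K 1).mul_mem_left _ (E_mem_P _ _ _)
  | zero => exact zero_mem _
  | add z w _ _ hz hw => exact add_mem hz hw
  | smul c z _ hz => exact smul_mem_ideal c hz

theorem mem_P_of_rho_eq_zero' {z : OSIAlg K 2} (hz : rho K (i + 1) z = 0) : z ∈ P K i := by
  have := mem_P_of_rho_eq_zero (i + 1) hz
  rwa [fin_two_add_one_add_one] at this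

theorem rho_eq_zero_of_mem_P' {z : OSIAlg K 2} (hz : z ∈ P K i) : rho K (i + 1) z = 0 := by
  refine rho_eq_zero_of_mem_P (i + 1) ?_
  rwa [fin_two_add_one_add_one]

theorem mem_F2_of_rho_eq_zero {z : OSIAlg K 2} (h : rho K i z = 0) (h' : rho K (i + 1) z = 0) :
    z ∈ F2 K :=
  mem_F2_of_mem_P (mem_P_of_rho_eq_zero' i h') (mem_P_of_rho_eq_zero i h)

theorem rhoU_eq_one_iff {u : (OSIAlg K 2)ˣ} :
    rhoU K i u = 1 ↔ (u : OSIAlg K 2) - 1 ∈ P K (i + 1) := by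
  rw [Units.ext_iff, val_rhoU, Units.val_one]
  constructor
  · intro h
    refine mem_P_of_rho_eq_zero i (LinearMap.ext fun v => ?_)
    rw [map_sub_apply, h, map_one, sub_self]
    rfl
  · intro h
    rw [← sub_add_cancel (u : OSIAlg K 2) 1, map_add, rho_eq_zero_of_mem_P i h, zero_add, map_one]

theorem rhoU_eq_one_iff' {u : (OSIAlg K 2)ˣ} :
    rhoU K (i + 1) u = 1 ↔ (u : OSIAlg K 2) - 1 ∈ P K i := by
  rw [rhoU_eq_one_iff, fin_two_add_one_add_one]

/-- Combines F_2 = P_i ∩ P_{i+1} with the kernels of the two representations. It identifies the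
intersection in the box product. -/
theorem mem_unitsOneAddF2_iff {u : (OSIAlg K 2)ˣ} :
    u ∈ unitsOneAddF2 K ↔ rhoU K i u = 1 ∧ rhoU K (i + 1) u = 1 := by
  constructor
  · rintro ⟨h, -⟩
    exact ⟨(rhoU_eq_one_iff i).2 (F2_le_P _ h), (rhoU_eq_one_iff _).2 (F2_le_P _ h)⟩
  · rintro ⟨h, h'⟩
    refine ⟨mem_F2_of_mem_P ((rhoU_eq_one_iff' i).1 h') ((rhoU_eq_one_iff i).1 h),
      mem_F2_of_mem_P (i := i) ((rhoU_eq_one_iff' i).1 ?_) ((rhoU_eq_one_iff i).1 ?_)⟩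
    · rw [map_inv, h', inv_one]
    · rw [map_inv, h, inv_one]

theorem F2_le_span : F2 K ≤ Submodule.span K (Set.range fun q : (ℕ × ℕ) × (ℕ × ℕ) =>
    E K i q.1.1 q.2.1 * E K (i + 1) q.1.2 q.2.2) := by
  refine Submodule.span_le.2 ?_
  rintro _ ⟨α, β, rfl⟩
  obtain rfl | rfl := fin_two_eq_or 0 i
  · exact Submodule.subset_span ⟨((α 0, α 1), (β 0, β 1)), rfl⟩
  · refine Submodule.subset_span ⟨((α 1, α 0), (β 1, β 0)), ?_⟩
    exact (commute_E_E K (ne_add_one 0) (α 0) (β 0) (α 1) (β 1)).eq.symm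

/-- The products of matrix units that span F_2 go to distinct matrix units on ℕ × ℕ, which are
linearly independent. -/
theorem eq_zero_of_tau_eq_zero {z : OSIAlg K 2} (hz : z ∈ F2 K) (h : tau K i z = 0) : z = 0 := by
  obtain ⟨c, rfl⟩ := Finsupp.mem_span_range_iff_exists_finsupp.1 (F2_le_span i hz)
  suffices hc : c = 0 by rw [hc, Finsupp.sum_zero_index]
  ext ⟨a, b⟩
  have h1 := congrArg (fun g : FinEnd K (ℕ × ℕ) => g (Finsupp.single b 1) a) h
  simp only [Finsupp.sum, map_sum, map_smul, LinearMap.sum_apply, Finsupp.finsetSum_apply,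
    LinearMap.smul_apply, Finsupp.smul_apply, LinearMap.zero_apply,
    Finsupp.zero_apply, tau_E_mul_E, Prod.mk.eta, matUnit_apply] at h1
  rw [Finset.sum_eq_single (a, b)] at h1
  · simpa using h1
  · rintro ⟨a', b'⟩ _ hne
    by_cases hb : b = b'
    · have ha : a' ≠ a := by
        rintro rfl
        exact hne (by rw [hb])
      simp [ha]
    · simp [hb]
  · intro h
    rw [Finsupp.notMem_support_iff.1 h, zero_smul]

theorem exists_finset_tau {z : OSIAlg K 2} (hz : z ∈ F2 K) :
    ∃ s : Finset (ℕ × ℕ), (∀ j ∉ s, tau K i z (Finsupp.single j 1) = 0) ∧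
      ∀ k ∉ s, ∀ v, tau K i z v k = 0 := by
  have hz' := F2_le_span i hz
  clear hz
  induction hz' using Submodule.span_induction with
  | mem z h =>
    obtain ⟨⟨a, b⟩, rfl⟩ := h
    refine ⟨{a, b}, fun j hj => ?_, fun k hk v => ?_⟩
    · have : j ≠ b := by rintro rfl; simp at hj
      rw [tau_E_mul_E, Prod.mk.eta, Prod.mk.eta, matUnit_apply, Finsupp.single_apply, if_neg this,
        Finsupp.single_zero]
    · have : a ≠ k := by rintro rfl; simp at hk
      rw [tau_E_mul_E, Prod.mk.eta, Prod.mk.eta, matUnit_apply, Finsupp.single_apply, if_neg this]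
  | zero => exact ⟨∅, fun _ _ => by rw [map_zero]; rfl, fun _ _ _ => by rw [map_zero]; rfl⟩
  | add z w _ _ hz hw =>
    obtain ⟨s, h1, h2⟩ := hz
    obtain ⟨t, h3, h4⟩ := hw
    refine ⟨s ∪ t, fun j hj => ?_, fun k hk v => ?_⟩
    · rw [Finset.notMem_union] at hj
      rw [map_add, LinearMap.add_apply, h1 j hj.1, h3 j hj.2, add_zero]
    · rw [Finset.notMem_union] at hk
      rw [map_add, LinearMap.add_apply, Finsupp.add_apply, h2 k hk.1, h4 k hk.2, add_zero]
  | smul c z _ hz =>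
    obtain ⟨s, h1, h2⟩ := hz
    refine ⟨s, fun j hj => ?_, fun k hk v => ?_⟩
    · rw [map_smul, LinearMap.smul_apply, h1 j hj, smul_zero]
    · rw [map_smul, LinearMap.smul_apply, Finsupp.smul_apply, h2 k hk, smul_zero]

/-- The action of `tau i` on units. -/
noncomputable def tauU (K : Type*) [Field K] (i : Fin 2) :
    (OSIAlg K 2)ˣ →* (FinEnd K (ℕ × ℕ))ˣ :=
  Units.map (tau K i : OSIAlg K 2 →* FinEnd K (ℕ × ℕ))

theorem val_tauU (u : (OSIAlg K 2)ˣ) : (tauU K i u : FinEnd K (ℕ × ℕ)) = tau K i u := rfl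

/-- Taking the coefficient a = c E_pq(i+1) puts 1 + a E_kl(i) into 1 + F_2. This reaches only
transvections whose first coordinates differ. -/
theorem exists_tauU_eq_transvection (c : K) {k l : ℕ} (hkl : k ≠ l) (p q : ℕ) :
    ∃ g ∈ EInf K i ⊓ unitsOneAddF2 K, (tauU K i g : FinEnd K (ℕ × ℕ)) =
      1 + c • matUnit K (k, p) (l, q) := by
  have hE : E K (i + 1) p q ∈ S1 K (i + 1) := by
    obtain ⟨hx, hy⟩ := x_mem_y_mem_S1 (K := K) (i + 1)
    exact sub_mem (mul_mem (pow_mem hx _) (pow_mem hy _)) (mul_mem (pow_mem hx _) (pow_mem hy _))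
  have hval : ((c • ⟨E K (i + 1) p q, hE⟩ : S1 K (i + 1)) : OSIAlg K 2) * E K i k l =
      c • (E K i k l * E K (i + 1) p q) := by
    rw [Subalgebra.coe_smul, smul_mul_assoc, (commute_E_E K (ne_add_one i) k l p q).eq]
  refine ⟨_, ⟨elementary_mem_EInf i (c • ⟨E K (i + 1) p q, hE⟩) hkl, ?_, ?_⟩, ?_⟩
  · rw [val_elementary, hval, add_sub_cancel_left]
    exact Submodule.smul_mem _ _ (E_mul_E_mem_F2 _ _ _ _ _)
  · change 1 - _ - 1 ∈ _
    rw [hval, sub_sub_cancel_left]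
    exact neg_mem (Submodule.smul_mem _ _ (E_mul_E_mem_F2 _ _ _ _ _))
  · rw [val_tauU, val_elementary, hval, map_add, map_one, map_smul, tau_E_mul_E]

theorem endElementary_le_map_tauU :
    endElementary K (ℕ × ℕ) ≤ (EInf K i ⊓ unitsOneAddF2 K).map (tauU K i) := by
  have h1 : ∀ (a b : ℕ × ℕ) (h : a ≠ b), a.1 ≠ b.1 → ∀ c : K,
      endTransvection h c ∈ (EInf K i ⊓ unitsOneAddF2 K).map (tauU K i) := by
    rintro ⟨k, p⟩ ⟨l, q⟩ h hkl c
    obtain ⟨g, hg, hg'⟩ := exists_tauU_eq_transvection i c hkl p q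
    exact ⟨g, hg, Units.ext hg'⟩
  refine (Subgroup.closure_le _).2 ?_
  rintro _ ⟨⟨k, p⟩, ⟨l, q⟩, h, c, rfl⟩
  by_cases hkl : k = l
  · subst hkl
    -- For equal first coordinates, a commutator through the auxiliary index (k + 1, p) produces the
    -- transvection.
    have ha : ((k, p) : ℕ × ℕ) ≠ (k + 1, p) := by simp
    have hb : ((k + 1, p) : ℕ × ℕ) ≠ (k, q) := by simp
    have key : endTransvection h c = endTransvection ha c * endTransvection hb 1 *
        endTransvection ha (-c) * endTransvection hb (-1) := by
      refine Units.ext (LinearMap.ext fun v => ?_)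
      simp only [Units.val_mul, Module.End.mul_apply, endTransvection_apply]
      have hpq : p ≠ q := by rintro rfl; exact h rfl
      ext ⟨s, t⟩
      simp [Finsupp.single_apply, hpq.symm]
      split_ifs <;> ring
    rw [SetLike.mem_coe, key]
    exact mul_mem (mul_mem (mul_mem (h1 _ _ _ (by simp) _) (h1 _ _ _ (by simp) _))
      (h1 _ _ _ (by simp) _)) (h1 _ _ _ (by simp) _)
  · exact h1 _ _ _ hkl c

/-- The units of `1 + F_2` are products of elementary matrices. -/
theorem unitsOneAddF2_le_EInf : unitsOneAddF2 K ≤ EInf K i := by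
  intro u hu
  obtain ⟨s, h1, h2⟩ := exists_finset_tau i hu.1
  have htu : tau K i u = 1 + tau K i ((u : OSIAlg K 2) - 1) := by
    rw [← map_one (tau K i), ← map_add, add_sub_cancel]
  have hs : IsBlock s (tauU K i u : FinEnd K (ℕ × ℕ)) := by
    refine ⟨fun j hj => ?_, fun k hk v => ?_⟩
    · rw [val_tauU, htu, LinearMap.add_apply, h1 j hj, add_zero]; rfl
    · rw [val_tauU, htu, LinearMap.add_apply, Finsupp.add_apply, h2 k hk, add_zero]; rfl
  obtain ⟨N, hN⟩ := Field.exists_euclidean K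
  -- The pivot is (1, 0) because E_11(i) E_00(i+1) is the diagonal position that
  -- `exists_mem_EInf_eq` realises inside `EInf K i`.
  obtain ⟨g, hg, g', hg', d, hd⟩ := exists_elementary_reduction hN (1, 0) (s.erase (1, 0))
    (Finset.notMem_erase _ _) (tauU K i u)
    (hs.mono fun k hk => by by_cases h : k = (1, 0) <;> simp [h, hk])
  obtain ⟨g, ⟨hgE, hgF⟩, rfl⟩ := endElementary_le_map_tauU i hg
  obtain ⟨g', ⟨hgE', hgF'⟩, rfl⟩ := endElementary_le_map_tauU i hg'
  rw [← map_mul, ← map_mul, val_tauU] at hd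
  obtain ⟨w, hw, hwd⟩ := exists_mem_EInf_eq i d
  have hF : g * u * g' ∈ unitsOneAddF2 K := mul_mem (mul_mem hgF hu) hgF'
  have heq : g * u * g' = w := by
    refine Units.ext (sub_eq_zero.1 (eq_zero_of_tau_eq_zero i ?_ ?_))
    · rw [hwd, ← sub_sub]
      exact sub_mem hF.1 (Submodule.smul_mem _ _ (E_mul_E_mem_F2 _ _ _ _ _))
    · refine LinearMap.ext fun v => ?_
      rw [map_sub_apply, hd, hwd, map_add, map_one, map_smul, tau_E_mul_E, sub_self]
      rfl
  have : u = g⁻¹ * w * g'⁻¹ := by rw [← heq]; group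
  rw [this]
  exact mul_mem (mul_mem (inv_mem hgE) hw) (inv_mem hgE')

end FTwo

end OSI
-- Index arguments: exponents of units vanish.
namespace OSI

open LaurentPolynomial

section Index

theorem sub_one_smul_apply {R : Type*} [CommRing R] {ι : Type*} (a : R) (A : FinEnd R ι)
    (v : ι →₀ R) : ((a - 1) • A) v = a • A v - A v := by
  ext j
  simp [sub_mul]

variable {K : Type*} [Field K] (i : Fin 2)

theorem rho_injective (u : (OSIAlg K 2)ˣ) : Function.Injective (rho K i u) := by
  refine Function.LeftInverse.injective (g := rho K i ((u⁻¹ : (OSIAlg K 2)ˣ) : OSIAlg K 2))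
    fun v => ?_
  rw [← Module.End.mul_apply, ← map_mul, Units.inv_mul, map_one]
  rfl

theorem tau_injective (u : (OSIAlg K 2)ˣ) : Function.Injective (tau K i u) := by
  refine Function.LeftInverse.injective (g := tau K i ((u⁻¹ : (OSIAlg K 2)ˣ) : OSIAlg K 2))
    fun v => ?_
  rw [← Module.End.mul_apply, ← map_mul, Units.inv_mul, map_one]
  rfl

/-- Under `rho K i` the unit is a shift by a, times a scalar, plus a finite matrix. For a < 0 it
would map the first n + |a| basis vectors into the span of the first n, contradicting injectivity.
-/
theorem nonneg_of_sub_mem_sup_P (u : (OSIAlg K 2)ˣ) (c : K) (a b : ℤ)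
    (h : (u : OSIAlg K 2) - c • (xz i a * xz (i + 1) b) ∈ P K i ⊔ P K (i + 1)) : 0 ≤ a := by
  obtain ⟨p, hp, q, hq, hpq⟩ := Submodule.mem_sup.1 h
  obtain ⟨s, -, hs⟩ := exists_finset_rho i hp
  have hu : rho K i u = rho K i p + c • (rho K i (xz i a) * rho K i (xz (i + 1) b)) := by
    rw [← sub_add_cancel (u : OSIAlg K 2) (c • (xz i a * xz (i + 1) b)), ← hpq, map_add, map_add,
      rho_eq_zero_of_mem_P i hq, add_zero, map_smul, map_mul]
  by_contra ha
  push Not at ha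
  obtain ⟨n, hn⟩ := s.exists_nat_subset_range
  have key := card_le_card_of_injective_of_apply_mem (rho_injective i u)
    (s := Finset.range (n + a.natAbs)) (t := Finset.range n) ?_
  · rw [Finset.card_range, Finset.card_range] at key
    omega
  · intro j hj k hk
    rw [Finset.mem_range] at hj hk
    rw [hu, LinearMap.add_apply, Finsupp.add_apply, hs k fun hks => hk (Finset.mem_range.1 (hn hks)),
      zero_add, LinearMap.smul_apply, Finsupp.smul_apply, Module.End.mul_apply, rho_xz_apply,
      rho_xz', if_neg (by omega), LinearMap.smul_apply, Finsupp.smul_apply, Module.End.one_apply,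
      Finsupp.single_apply, if_neg (by omega), smul_zero, smul_zero]

theorem commute_xz_xz (a b : ℤ) : Commute (xz (K := K) i a) (xz (i + 1) b) := by
  have hij := ne_add_one i
  refine (commute_xz i (commute_xz _ ?_ ?_ b).symm (commute_xz _ ?_ ?_ b).symm a).symm
  · exact commute_x_x K hij
  · exact commute_x_y K hij
  · exact (commute_x_y K hij.symm).symm
  · exact commute_y_y K hij

/-- A unit of `𝕊_2` is a scalar modulo `P 0 + P 1`. -/
theorem exists_sub_smul_one_mem (u : (OSIAlg K 2)ˣ) :
    ∃ c : Kˣ, (u : OSIAlg K 2) - (c : K) • 1 ∈ P K 0 ⊔ P K 1 := by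
  obtain ⟨f, a, hfa⟩ := exists_eq_C_mul_T_of_isUnit ((u.isUnit).map (eps K 0))
  obtain ⟨c, b, hcb⟩ := exists_eq_C_mul_T_of_isUnit f.isUnit
  have hmon : ∀ (c : K) (a b : ℤ), eps K 0 (c • (xz 0 a * xz 1 b)) = C (C c * T b) * T a := by
    intro c a b
    have h1 : eps K 0 (xz 1 b) = C (T b) := eps_xz' 0 b
    rw [map_smul, map_mul, eps_xz, h1, Algebra.smul_def, map_mul, mul_assoc, mul_comm (T a)]
    rfl
  have hu : eps K 0 u = C (C (c : K) * T b) * T a := by rw [hfa, hcb]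
  have huinv : eps K 0 ((u⁻¹ : (OSIAlg K 2)ˣ) : OSIAlg K 2) =
      C (C ((c⁻¹ : Kˣ) : K) * T (-b)) * T (-a) := by
    refine left_inv_eq_right_inv (a := eps K 0 u) ?_ ?_
    · rw [← map_mul, Units.inv_mul, map_one]
    · rw [hu, mul_mul_mul_comm, ← T_add, ← map_mul, mul_mul_mul_comm, ← T_add, ← map_mul]
      simp
  have hsub : ∀ (v : (OSIAlg K 2)ˣ) (c : K) (a b : ℤ), eps K 0 v = C (C c * T b) * T a →
      0 ≤ a ∧ 0 ≤ b ∧ (v : OSIAlg K 2) - c • (xz 0 a * xz 1 b) ∈ P K 0 ⊔ P K 1 := by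
    intro v c a b hv
    have hmem : (v : OSIAlg K 2) - c • (xz 0 a * xz 1 b) ∈ P K 0 ⊔ P K 1 :=
      mem_sup_P_of_eps_eq_zero 0 (by rw [map_sub, hv, hmon, sub_self])
    refine ⟨nonneg_of_sub_mem_sup_P 0 v c a b hmem, nonneg_of_sub_mem_sup_P 1 v c b a ?_, hmem⟩
    have hc : xz (K := K) (0 : Fin 2) a * xz 1 b = xz 1 b * xz 0 a := (commute_xz_xz 0 a b).eq
    rw [hc, sup_comm] at hmem
    exact hmem
  -- The inverse has exponents -a and -b, so the one-sided bound applied to both units gives a = b =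
  -- 0.
  obtain ⟨ha, hb, hmem⟩ := hsub u c a b hu
  obtain ⟨ha', hb', -⟩ := hsub _ _ _ _ huinv
  obtain rfl : a = 0 := by omega
  obtain rfl : b = 0 := by omega
  rw [xz_zero, xz_zero, mul_one] at hmem
  exact ⟨c, hmem⟩

/-- The hypotheses determine v modulo F_2: on K[x_1,x_2], up to a finite matrix, it shifts the line
of exponents (0, q) by m and fixes the other basis vectors. A negative m contradicts injectivity by
counting dimensions. -/
theorem nonneg_of_rhoU_eq_diag {v : (OSIAlg K 2)ˣ} {m : ℤ} (h' : rhoU K (i + 1) v = 1)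
    (h : rhoU K i v = diagHom 0 (unitT K ^ m)) : 0 ≤ m := by
  set w : OSIAlg K 2 := (xz (i + 1) m - 1) * E K i 0 0 with hw
  have hrw : ∀ v, rho K i w v = ((T m - 1 : K[T;T⁻¹]) • matUnit K[T;T⁻¹] 0 0) v := by
    intro v
    rw [hw, map_mul, Module.End.mul_apply, map_sub_apply, rho_xz', map_one, rho_E,
      sub_one_smul_apply]
    rfl
  have hF : (v : OSIAlg K 2) - 1 - w ∈ F2 K := by
    refine mem_F2_of_rho_eq_zero i (LinearMap.ext fun z => ?_) (rho_eq_zero_of_mem_P' i ?_)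
    · rw [map_sub_apply, map_sub_apply, hrw, ← val_rhoU, h, val_diagHom, val_unitT_zpow, map_one,
        LinearMap.add_apply, add_sub_cancel_left, sub_self]
      rfl
    · exact sub_mem ((rhoU_eq_one_iff' i).1 h') ((P K i).mul_mem_left _ (E_mem_P _ _ _))
  obtain ⟨s, -, hs⟩ := exists_finset_tau i hF
  have htv : tau K i v = 1 + tau K i w + tau K i ((v : OSIAlg K 2) - 1 - w) := by
    rw [← map_one (tau K i), ← map_add, ← map_add]
    congr 1
    abel
  obtain ⟨n₁, hn₁⟩ := (s.image Prod.fst).exists_nat_subset_range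
  obtain ⟨n₂, hn₂⟩ := (s.image Prod.snd).exists_nat_subset_range
  have hsn : ∀ p q, (p, q) ∈ s → p < n₁ ∧ q < n₂ := fun p q hpq =>
    ⟨Finset.mem_range.1 (hn₁ (Finset.mem_image_of_mem Prod.fst hpq)),
      Finset.mem_range.1 (hn₂ (Finset.mem_image_of_mem Prod.snd hpq))⟩
  by_contra hm
  push Not at hm
  have hdisj : ∀ n, Disjoint (Finset.Icc 1 n₁ ×ˢ Finset.range n₂)
      (({0} : Finset ℕ) ×ˢ Finset.range n) := by
    intro n
    rw [Finset.disjoint_left]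
    rintro ⟨p, q⟩ h1 h2
    simp only [Finset.mem_product, Finset.mem_Icc, Finset.mem_singleton] at h1 h2
    omega
  -- Both sets contain the box outside which the finite correction has no rows. On the line p = 0
  -- the source is longer by |m|, exactly what the backward shift pushes into the target.
  have key := card_le_card_of_injective_of_apply_mem (tau_injective i v)
    (s := (Finset.Icc 1 n₁ ×ˢ Finset.range n₂) ∪ ({0} ×ˢ Finset.range (n₂ + m.natAbs)))
    (t := (Finset.Icc 1 n₁ ×ˢ Finset.range n₂) ∪ ({0} ×ˢ Finset.range n₂)) ?_
  · rw [Finset.card_union_of_disjoint (hdisj _), Finset.card_union_of_disjoint (hdisj _),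
      Finset.card_product, Finset.card_product, Finset.card_product] at key
    simp only [Finset.card_range, Finset.card_singleton] at key
    omega
  · rintro ⟨p, q⟩ hpq ⟨p', q'⟩ hpq'
    simp only [Finset.mem_union, Finset.mem_product, Finset.mem_Icc, Finset.mem_range,
      Finset.mem_singleton] at hpq hpq'
    have hs' : (p', q') ∉ s := fun hmem => by
      have := hsn _ _ hmem
      omega
    rw [htv, LinearMap.add_apply, Finsupp.add_apply, hs _ hs', add_zero, LinearMap.add_apply,
      Finsupp.add_apply, Module.End.one_apply, hw, map_mul, Module.End.mul_apply, map_sub_apply,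
      Finsupp.sub_apply, map_one, Module.End.one_apply, tau_xz'_apply, if_neg (by omega),
      tau_E_apply, tau_E_apply]
    by_cases hp' : p' = 0
    · rw [if_pos hp', if_pos hp', hp', add_sub_cancel, Finsupp.single_apply, if_neg]
      rw [Prod.mk.injEq]
      omega
    · rw [if_neg hp', if_neg hp', sub_self, add_zero, Finsupp.single_apply, if_neg]
      rw [Prod.mk.injEq]
      omega

/-- Units with trivial image under `rho (i+1)` have constant determinant under `rho i`. -/
theorem eq_zero_of_rhoU_eq_diag {v : (OSIAlg K 2)ˣ} {m : ℤ} (h' : rhoU K (i + 1) v = 1)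
    (h : rhoU K i v = diagHom 0 (unitT K ^ m)) : m = 0 := by
  have h1 := nonneg_of_rhoU_eq_diag i h' h
  have h2 := nonneg_of_rhoU_eq_diag i (v := v⁻¹) (m := -m) (by rw [map_inv, h', inv_one])
    (by rw [map_inv, h, ← map_inv, zpow_neg])
  omega

end Index

/-! ### The kernels of `rhoU`, the unit θ, and the factorisation of a general unit. -/

section Decomposition

variable {K : Type*} [Field K] (i : Fin 2)

theorem mu_mem_ker (c : Kˣ) : rhoU K (i + 1) (mu K i c) = 1 := by
  have := rhoU_mu' (i + 1) c
  rwa [fin_two_add_one_add_one] at this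

theorem rhoU_EInf_succ {g : (OSIAlg K 2)ˣ} (hg : g ∈ EInf K i) : rhoU K (i + 1) g = 1 := by
  refine rhoU_EInf' (i + 1) ?_
  rwa [fin_two_add_one_add_one]

theorem conj_mu_mem_EInf' (c : Kˣ) {g : (OSIAlg K 2)ˣ} (hg : g ∈ EInf K i) :
    (mu K i c)⁻¹ * g * mu K i c ∈ EInf K i := by
  simpa using conj_mu_mem_EInf i c⁻¹ hg

/-- A unit with trivial image under `rho (i+1)` lies in `U_i(K) E_∞(𝕊_1(i+1))`. -/
theorem exists_eq_mu_mul {u : (OSIAlg K 2)ˣ} (hu : rhoU K (i + 1) u = 1) :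
    ∃ c : Kˣ, ∃ g ∈ EInf K i, u = mu K i c * g := by
  have hu1 : (u : OSIAlg K 2) - 1 ∈ P K 0 ⊔ P K 1 := by
    rw [← sup_P_eq i]
    exact Submodule.mem_sup_left ((rhoU_eq_one_iff' i).1 hu)
  obtain ⟨g, hg, g', hg', c, m, h⟩ := exists_rhoU_eq_diag i hu1
  set v := (mu K i c)⁻¹ * (g * u * g') with hv
  have hv1 : rhoU K (i + 1) v = 1 := by
    rw [hv, map_mul, map_inv, map_mul, map_mul, mu_mem_ker, rhoU_EInf_succ i hg,
      rhoU_EInf_succ i hg', hu]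
    simp
  have hv2 : rhoU K i v = diagHom 0 (unitT K ^ m) := by
    rw [hv, map_mul, h, map_inv, inv_mul_cancel_left]
  obtain rfl := eq_zero_of_rhoU_eq_diag i hv1 hv2
  rw [zpow_zero, map_one] at hv2
  -- With m = 0 both representations are trivial on v, so v lies in (1+F_2)^* and hence in the
  -- elementary group.
  have hvE := unitsOneAddF2_le_EInf i ((mem_unitsOneAddF2_iff i).2 ⟨hv2, hv1⟩)
  refine ⟨c, ((mu K i c)⁻¹ * g⁻¹ * mu K i c) * v * g'⁻¹,
    mul_mem (mul_mem (conj_mu_mem_EInf' i c (inv_mem hg)) hvE) (inv_mem hg'), ?_⟩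
  rw [hv]
  group

/-- The kernel is U_i times `EInf K i`, and U_i normalises `EInf K i`, whence normality. An element
of the intersection has image diag(c, 1, ...) of determinant 1, so c = 1. -/
theorem isInternalSemidirect_ker :
    IsInternalSemidirect (rhoU K (i + 1)).ker (U K i) (EInf K i) where
  left_le := by
    rintro _ ⟨c, rfl⟩
    exact mu_mem_ker i c
  right_le := fun g hg => rhoU_EInf_succ i hg
  right_normal := by
    refine ⟨fun n hn g => ?_⟩
    rw [Subgroup.mem_subgroupOf] at hn ⊢
    obtain ⟨c, e, he, hce⟩ := exists_eq_mu_mul i g.2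
    have : ((g * n * g⁻¹ : (rhoU K (i + 1)).ker) : (OSIAlg K 2)ˣ) =
        mu K i c * (e * n * e⁻¹) * (mu K i c)⁻¹ := by
      push_cast
      rw [hce]
      group
    rw [this]
    exact conj_mu_mem_EInf i c (mul_mem (mul_mem he hn) (inv_mem he))
  inf_eq := by
    rw [eq_bot_iff]
    rintro _ ⟨⟨c, rfl⟩, hc⟩
    have h1 := rhoU_mem_endElementary i hc
    rw [rhoU_mu] at h1
    have h2 := eq_one_of_diag_mem_endElementary h1 (val_diagHom _ _)
    have h3 : c = 1 := by
      refine Units.ext ?_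
      have h4 : (C (c : K) : K[T;T⁻¹]).coeff 0 = (1 : K[T;T⁻¹]).coeff 0 :=
        congrArg (fun f : K[T;T⁻¹] => f.coeff 0) h2
      rw [← map_one (C : K →+* K[T;T⁻¹]), C_apply, C_apply, if_pos rfl, if_pos rfl] at h4
      exact h4
    rw [h3, map_one]
    exact one_mem _
  exists_eq_mul := by
    intro g hg
    obtain ⟨c, e, he, h⟩ := exists_eq_mu_mul i hg
    exact ⟨_, ⟨c, rfl⟩, e, he, h⟩

/-- `rho K 1` kills E_00(0), so the second factor of θ becomes 1, while y_0 acts in the first factor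
as T⁻¹. -/
theorem rhoU_theta : rhoU K 1 (theta K) = diagHom 0 (unitT K)⁻¹ := by
  have hE1 : rho K 1 (E K 0 0 0) = 0 := rho_E' 1 0 0
  have hy : rho K 1 (y K 0) = ((unitT K)⁻¹ : K[T;T⁻¹]ˣ).val • 1 := rhoUnit_y' _ 1
  refine Units.ext (LinearMap.ext fun v => ?_)
  change rho K 1 ((1 + (y K 0 - 1) * E K 1 0 0) * (1 + E K 0 0 0 * (x K 1 - 1))) v = _
  rw [map_mul, map_add _ 1 (E K 0 0 0 * _), map_mul _ (E K 0 0 0), hE1, zero_mul, add_zero,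
    map_one, mul_one, map_add, map_one, map_mul, LinearMap.add_apply, Module.End.mul_apply,
    map_sub_apply, hy, map_one, rho_E, val_diagHom, LinearMap.add_apply, sub_one_smul_apply]
  rfl

theorem eps_theta : eps K 0 (theta K) = 1 := by
  have hE : ∀ k, eps K 0 (E K k 0 0) = 0 := fun k => map_E_eq_zero (eps_x_mul_y 0 k) 0 0
  change eps K 0 ((1 + (y K 0 - 1) * E K 1 0 0) * (1 + E K 0 0 0 * (x K 1 - 1))) = 1
  rw [map_mul, map_add, map_add, map_mul, map_mul, hE, hE]
  simp

theorem eps_eq_one_of_mem_ker {u : (OSIAlg K 2)ˣ} (hu : rhoU K i u = 1) : eps K 0 u = 1 := by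
  have := eps_eq_zero_of_mem_P 0 ((rhoU_eq_one_iff i).1 hu)
  rwa [map_sub, map_one, sub_eq_zero] at this

theorem scalar_injective : Function.Injective (scalar K 2) := by
  intro c d h
  have h1 : algebraMap K (OSIAlg K 2) c = algebraMap K (OSIAlg K 2) d := congrArg Units.val h
  have h2 := congrArg (eps K 0) h1
  rw [AlgHom.commutes, AlgHom.commutes] at h2
  exact Units.ext ((algebraMap K K[T;T⁻¹][T;T⁻¹]).injective h2)

theorem mu_injective : Function.Injective (mu K i) := by
  intro c d h
  have h1 := congrArg (fun u : (OSIAlg K 2)ˣ =>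
    (tau K i u (Finsupp.single (0, 0) 1)) (0, 0)) h
  simp only [val_mu, map_add, map_one, map_smul, LinearMap.add_apply, LinearMap.smul_apply,
    Finsupp.add_apply, Finsupp.smul_apply, tau_E_apply] at h1
  exact Units.ext (by simpa using h1)

/-- A power of `θ` lying in the product of the two kernels is trivial. -/
theorem eq_zero_of_theta_zpow_mem {m : ℤ}
    (h : theta K ^ m ∈ (rhoU K 1).ker ⊔ (rhoU K 0).ker) : m = 0 := by
  obtain ⟨a, ha, b, hb, hab⟩ := Subgroup.mem_sup_of_normal_left.1 h
  have h1 : rhoU K 1 b = diagHom 0 (unitT K ^ (-m)) := by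
    have := congrArg (rhoU K 1) hab
    rw [map_mul, MonoidHom.mem_ker.1 ha, one_mul, map_zpow, rhoU_theta, ← map_zpow, inv_zpow,
      ← zpow_neg] at this
    exact this
  have := eq_zero_of_rhoU_eq_diag 1 (v := b) (MonoidHom.mem_ker.1 hb) h1
  omega

/-- Every unit is the product of a scalar, a power of `θ` and an element of the two kernels. -/
theorem exists_eq_scalar_mul (u : (OSIAlg K 2)ˣ) : ∃ c : Kˣ,
    ∃ h ∈ Theta K ⊔ ((rhoU K 1).ker ⊔ (rhoU K 0).ker), u = scalar K 2 c * h := by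
  obtain ⟨c, hc⟩ := exists_sub_smul_one_mem u
  refine ⟨c, (scalar K 2 c)⁻¹ * u, ?_, (mul_inv_cancel_left _ _).symm⟩
  have hval : (((scalar K 2 c)⁻¹ * u : (OSIAlg K 2)ˣ) : OSIAlg K 2) =
      ((c⁻¹ : Kˣ) : K) • (u : OSIAlg K 2) := by
    rw [← map_inv, Units.val_mul, Algebra.smul_def]
    rfl
  have hmem : (((scalar K 2 c)⁻¹ * u : (OSIAlg K 2)ˣ) : OSIAlg K 2) - 1 ∈ P K 0 ⊔ P K 1 := by
    have := smul_mem_ideal ((c⁻¹ : Kˣ) : K) hc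
    rwa [smul_sub, smul_smul, Units.inv_mul, one_smul, ← hval] at this
  obtain ⟨g, hg, g', hg', d, m, h⟩ := exists_rhoU_eq_diag 1 hmem
  set v := (scalar K 2 c)⁻¹ * u
  -- No index argument removes T^m here, since v need not lie in a kernel. Instead θ^{-m} has the
  -- image diag(T^m, 1, ...).
  set w := g * v * g' * (mu K 1 d * theta K ^ (-m))⁻¹ with hw
  have hwker : w ∈ (rhoU K 1).ker := by
    rw [MonoidHom.mem_ker, hw, map_mul, h, map_inv, map_mul, map_zpow (rhoU K 1), rhoU_theta, ← map_zpow,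
      inv_zpow, ← zpow_neg, neg_neg, mul_inv_cancel]
  have hv : v = g⁻¹ * w * mu K 1 d * theta K ^ (-m) * g'⁻¹ := by
    rw [hw]; group
  have hE : ∀ {z}, z ∈ EInf K 1 → z ∈ Theta K ⊔ ((rhoU K 1).ker ⊔ (rhoU K 0).ker) := fun hz =>
    Subgroup.mem_sup_right (Subgroup.mem_sup_right (rhoU_EInf_succ 1 hz))
  rw [hv]
  refine mul_mem (mul_mem (mul_mem (mul_mem (hE (inv_mem hg)) ?_) ?_) ?_) (hE (inv_mem hg'))
  · exact Subgroup.mem_sup_right (Subgroup.mem_sup_left hwker)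
  · exact Subgroup.mem_sup_right (Subgroup.mem_sup_right (mu_mem_ker 1 d))
  · exact Subgroup.mem_sup_left ⟨-m, rfl⟩

end Decomposition

end OSI

/-! ### Assembly of the decomposition. -/

theorem mainTheorem3 (K : Type*) [Field K] :
    ∃ A₁ A₂ M H : Subgroup (OSIAlg K 2)ˣ,
      -- `A₁ = U_1(K) ⋉ E_∞(𝕊_1(2))` and `A₂ = U_2(K) ⋉ E_∞(𝕊_1(1))`
      IsInternalSemidirect A₁ (OSI.U K (0 : Fin 2)) (OSI.EInf K 0) ∧
      IsInternalSemidirect A₂ (OSI.U K (1 : Fin 2)) (OSI.EInf K 1) ∧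
      -- `M = A₁ ⊠ A₂` over `(1 + F_2)^*`
      IsBoxProduct M A₁ A₂ (OSI.unitsOneAddF2 K) ∧
      -- `H = Θ ⋉ M`
      IsInternalSemidirect H (OSI.Theta K) M ∧
      -- `𝕊_2^* = K^* × H`
      IsInternalDirect ⊤ (OSI.scalar K 2).range H ∧
      -- `θ` has infinite order, and `K^*` embeds as the scalars and as `U_1(K)`, `U_2(K)`
      Function.Injective (fun m : ℤ => OSI.theta K ^ m) ∧
      Function.Injective (OSI.scalar K 2) ∧
      (∀ i : Fin 2, Function.Injective (OSI.mu K i)) := by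
  -- The indices cross: `rho K 1` kills the E_kl(0), so its kernel on units contains U_1(K) and
  -- E_∞(𝕊_1(2)) of the statement.
  set A₁ := (OSI.rhoU K 1).ker with hA₁
  set A₂ := (OSI.rhoU K 0).ker with hA₂
  set M := A₁ ⊔ A₂ with hM
  set H := OSI.Theta K ⊔ M with hH
  have hcentral : ∀ (c : Kˣ) (u : (OSIAlg K 2)ˣ), Commute (OSI.scalar K 2 c) u := fun c u =>
    Units.ext (Algebra.commutes (c : K) (u : OSIAlg K 2))
  refine ⟨A₁, A₂, M, H, OSI.isInternalSemidirect_ker 0, OSI.isInternalSemidirect_ker 1, ?_, ?_, ?_,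
    ?_, OSI.scalar_injective, OSI.mu_injective⟩
  · refine ⟨le_sup_left, le_sup_right, inferInstance, inferInstance, ?_, ?_⟩
    · ext u
      exact (and_comm.trans (OSI.mem_unitsOneAddF2_iff 0).symm)
    · intro g hg
      obtain ⟨a, ha, b, hb, h⟩ := Subgroup.mem_sup_of_normal_left.1 hg
      exact ⟨a, ha, b, hb, h.symm⟩
  · refine ⟨le_sup_left, le_sup_right, inferInstance, ?_, ?_⟩
    · rw [eq_bot_iff]
      rintro _ ⟨⟨m, rfl⟩, hm⟩
      obtain rfl := OSI.eq_zero_of_theta_zpow_mem hm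
      simp
    · intro g hg
      obtain ⟨a, ha, b, hb, h⟩ := Subgroup.mem_sup_of_normal_right.1 hg
      exact ⟨a, ha, b, hb, h.symm⟩
  -- Every unit is a central scalar times an element of H, so conjugation preserves H.
  · have hHn : H.Normal := by
      refine ⟨fun n hn g => ?_⟩
      obtain ⟨c, h, hh, rfl⟩ := OSI.exists_eq_scalar_mul g
      have : OSI.scalar K 2 c * h * n * (OSI.scalar K 2 c * h)⁻¹ = h * n * h⁻¹ := by
        rw [show OSI.scalar K 2 c * h * n * (OSI.scalar K 2 c * h)⁻¹ =
          OSI.scalar K 2 c * (h * n * h⁻¹) * (OSI.scalar K 2 c)⁻¹ by group, (hcentral c _).eq,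
          mul_inv_cancel_right]
      rw [this]
      exact mul_mem (mul_mem hh hn) (inv_mem hh)
    -- `eps` is trivial on H and injective on scalars, so H contains no scalar other than 1.
    have hHeps : ∀ h ∈ H, OSI.eps K 0 (h : OSIAlg K 2) = 1 := by
      have : H ≤ (Units.map (OSI.eps K 0 : OSIAlg K 2 →* LaurentPolynomial (LaurentPolynomial K))).ker := by
        refine sup_le ?_ (sup_le ?_ ?_)
        · exact (Subgroup.zpowers_le).2 (Units.ext OSI.eps_theta)
        · exact fun u hu => Units.ext (OSI.eps_eq_one_of_mem_ker 1 hu)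
        · exact fun u hu => Units.ext (OSI.eps_eq_one_of_mem_ker 0 hu)
      exact fun h hh => congrArg Units.val (this hh)
    refine ⟨le_top, le_top, ⟨fun n hn g => ?_⟩, inferInstance, ?_, ?_⟩
    · rw [Subgroup.mem_subgroupOf] at hn ⊢
      obtain ⟨c, hc⟩ := hn
      refine ⟨c, ?_⟩
      push_cast
      rw [← hc, ← (hcentral c g).eq, mul_inv_cancel_right]
    · rw [eq_bot_iff]
      rintro _ ⟨⟨c, rfl⟩, hc⟩
      have h1 : OSI.eps K 0 (algebraMap K (OSIAlg K 2) c) = 1 := hHeps _ hc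
      rw [AlgHom.commutes, ← map_one (algebraMap K _)] at h1
      have h2 : c = 1 := Units.ext ((algebraMap K _).injective h1)
      rw [h2, map_one]
      exact one_mem _
    · intro g _
      obtain ⟨c, h, hh, rfl⟩ := OSI.exists_eq_scalar_mul g
      exact ⟨_, ⟨c, rfl⟩, h, hh, rfl⟩
  · intro m n hmn
    have h1 : OSI.theta K ^ (m - n) = 1 := by
      rw [zpow_sub]
      exact mul_inv_eq_one.2 hmn
    have := OSI.eq_zero_of_theta_zpow_mem (K := K) (m := m - n) (by rw [h1]; exact one_mem _)
    omega
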